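/- Let $V=\bigoplus_{n\in\mathbb Z}V_{(n)}$ be a vertex operator algebra over $\mathbb C$, with vacuum $\mathbf 1$ and $Y(u,x)=\sum_{n\in\mathbb Z}u_nx^{-n-1}$. Let $h\in V_{(1)}$ be such that $[h_m,h_n]=0$ for all integers $m,n\ge 0$ and such that $h_0$ is locally finite on $V$ (every vector lies in a finite-dimensional $h_0$-stable subspace). For a commutative $\mathbb C$-algebra $R$ with a derivation $\partial$, let $V\otimes(R,\partial)$ be the tensor product vertex algebra, with vacuum $\mathbf 1\otimes 1$ and $Y_{ten}(u\otimes a,x)(w\otimes b)=Y(u,x)w\otimes(e^{x\partial}a)b$. An *$R$-valued pseudo-endomorphism* of $V$ is a linear map $\Delta:V\to V\otimes R$ with $\Delta(\mathbf 1)=\mathbf 1\otimes1$ and $\Delta(Y(u,x)w)=Y(e^{x(1\otimes\partial)}\Delta(u),x)\Delta(w)$ for $u,w\in V$, where $Y(u\otimes a,x)(w\otimes b)=Y(u,x)w\otimes ab$. It is a *pseudo-automorphism* if its $R$-linear extension to $V\otimes R$ is an automorphism of the vertex algebra $V\otimes(R,\partial)$. Let $R=\mathbb C[z^{-1}]\otimes\mathbb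 C[[y]]$ with the derivation $\partial=\frac{d}{dz}\otimes 1+z^{-1}\otimes\frac{d}{dy}$ (so $\partial y=z^{-1}$), and put $$X_{h,y}=\sum_{n\ge0}\frac1{n!}(\partial^ny)h_n=h_0\,y+\sum_{n\ge1}\frac{(-1)^{n-1}}{n}h_nz^{-n}:\ V\to V\otimes R .$$ 1. There is a unique linear map $\exp(X_{h,y}):V\to V\otimes R$ such that, for each $v\in V$, the series $\sum_{n\ge0}\frac1{n!}X_{h,y}^n(v)$ (with $X_{h,y}$ extended $R$-linearly to $V\otimes R$) converges to $\exp(X_{h,y})v$ in the $y$-adic topology of $V\otimes R$, and $\exp(X_{h,y})$ is an $R$-valued pseudo-automorphism of $V$. 2. Let $r$ be a positive integer such that all eigenvalues of $h_0$ on $V$ lie in $\frac1r\mathbb Z$, and let $K_r[y]$ be the subalgebra of $\mathbb C[[y]]$ generated by $y$ and $e^{\alpha y}=\sum_{n\ge0}\frac{\alpha^n}{n!}y^n$ for $\alpha\in\frac1r\mathbb Z$. Then $\exp(X_{h,y})$ takes values in $V\otimes\mathbb C[z^{-1}]\otimes K_r[y]$, and it is a $\mathbb C[z^{-1}]\otimes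 K_r[y]$-valued pseudo-endomorphism of $V$ (for the restriction of $\partial$). -/

import Mathlib

open scoped TensorProduct Nat

noncomputable section

namespace PseudoEnd

/-! ### Vertex algebras over the complex numbers -/

/-- The data underlying a vertex algebra on `W`: a vacuum vector `𝟏` and a linear vertex operator
map `Y(·, x) : W → Hom(W, W((x)))`. -/
structure VertexStructure (W : Type*) [AddCommGroup W] [Module ℂ W] where
  vacuum : W
  Y : W →ₗ[ℂ] VertexOperator ℂ W

namespace VertexStructure

variable {W : Type*} [AddCommGroup W] [Module ℂ W]

/-- `S.mode n u w` is `uₙ w`, where `Y(u, x) = ∑ₙ uₙ x^{-n-1}`. -/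
def mode (S : VertexStructure W) (n : ℤ) : W →ₗ[ℂ] W →ₗ[ℂ] W :=
  LinearMap.proj n ∘ₗ VertexOperator.ncoeff ∘ₗ S.Y

theorem mode_apply (S : VertexStructure W) (n : ℤ) (u w : W) :
    S.mode n u w = ((HahnModule.of ℂ).symm (S.Y u w)).coeff (-n - 1) := rfl

theorem exists_mode_eq_zero (S : VertexStructure W) (u w : W) :
    ∃ N : ℤ, ∀ n : ℤ, N ≤ n → S.mode n u w = 0 := by
  refine ⟨-HahnSeries.order ((HahnModule.of ℂ).symm (S.Y u w)), fun n hn => ?_⟩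
  rw [mode_apply]
  exact HahnSeries.coeff_eq_zero_of_lt_order (by omega)

/-- An automorphism: a bijective linear map `σ` with `σ(𝟏) = 𝟏` and
`σ(Y(u, x) w) = Y(σ(u), x) σ(w)` (compared coefficient by coefficient). -/
structure IsAutomorphism (S : VertexStructure W) (σ : W →ₗ[ℂ] W) : Prop where
  bijective : Function.Bijective σ
  map_vacuum : σ S.vacuum = S.vacuum
  map_mode : ∀ (n : ℤ) (u w : W), σ (S.mode n u w) = S.mode n (σ u) (σ w)

end VertexStructure

/-- A vertex algebra over `ℂ`; the Jacobi identity is stated in components. -/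
structure VertexAlgebra (V : Type*) [AddCommGroup V] [Module ℂ V] extends VertexStructure V where
  /-- `Y(𝟏, x) = 1`. -/
  vacuum_mode : ∀ (n : ℤ) (v : V), toVertexStructure.mode n vacuum v = if n = -1 then v else 0
  /-- `Y(v, x)𝟏` is a power series in `x` with constant term `v`. -/
  mode_vacuum : ∀ (n : ℕ) (v : V), toVertexStructure.mode n v vacuum = 0
  mode_neg_one_vacuum : ∀ v : V, toVertexStructure.mode (-1) v vacuum = v
  /-- The Jacobi (Borcherds) identity:
  `∑ᵢ C(m,i) (u_{l+i} v)_{m+n-i} w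
    = ∑ᵢ (-1)^i C(l,i) (u_{m+l-i} v_{n+i} w - (-1)^l v_{n+l-i} u_{m+i} w)`. -/
  jacobi : ∀ (l m n : ℤ) (u v w : V),
    ∑ᶠ i : ℕ, Ring.choose m i •
        toVertexStructure.mode (m + n - i) (toVertexStructure.mode (l + i) u v) w =
      ∑ᶠ i : ℕ, ((-1 : ℤ) ^ i * Ring.choose l i) •
        (toVertexStructure.mode (m + l - i) u (toVertexStructure.mode (n + i) v w) -
          (l.negOnePow : ℤ) •
            toVertexStructure.mode (n + l - i) v (toVertexStructure.mode (m + i) u w))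

/-- A vertex operator algebra: a vertex algebra with a conformal vector `ω` of central charge `c`.
With `L(n) = ω_{n+1}`, the homogeneous subspace `V_(n)` is the `n`-eigenspace of `L(0)`. -/
structure VertexOperatorAlgebra (V : Type*) [AddCommGroup V] [Module ℂ V]
    extends VertexAlgebra V where
  /-- The conformal vector. -/
  ω : V
  /-- The central charge. -/
  c : ℂ
  virasoro : ∀ m n : ℤ,
    ⁅toVertexStructure.mode (m + 1) ω, toVertexStructure.mode (n + 1) ω⁆ =
      ((m : ℂ) - n) • toVertexStructure.mode (m + n + 1) ω +
        if m + n = 0 then ((((m : ℂ) ^ 3 - m) / 12) * c) • (1 : Module.End ℂ V) else 0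
  /-- `Y(L(-1)v, x) = (d/dx) Y(v, x)`. -/
  L_neg_one : ∀ (n : ℤ) (v w : V),
    toVertexStructure.mode n (toVertexStructure.mode 0 ω v) w =
      -(n : ℂ) • toVertexStructure.mode (n - 1) v w
  /-- `V = ⨁_{n ∈ ℤ} V_(n)`. -/
  grading : DirectSum.IsInternal
    fun n : ℤ => Module.End.eigenspace (toVertexStructure.mode 1 ω) (n : ℂ)
  finite_weight : ∀ n : ℤ,
    FiniteDimensional ℂ (Module.End.eigenspace (toVertexStructure.mode 1 ω) (n : ℂ))
  bounded_weight : ∃ N : ℤ, ∀ n : ℤ, n < N →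
    Module.End.eigenspace (toVertexStructure.mode 1 ω) (n : ℂ) = ⊥

/-- The subspace `V_(n)` of vectors of conformal weight `n`. -/
def VertexOperatorAlgebra.weightSpace {V : Type*} [AddCommGroup V] [Module ℂ V]
    (S : VertexOperatorAlgebra V) (n : ℤ) : Submodule ℂ V :=
  Module.End.eigenspace (S.mode 1 S.ω) (n : ℂ)

/-- A linear operator is locally finite if every vector lies in a finite-dimensional invariant
subspace. -/
def IsLocallyFinite {V : Type*} [AddCommGroup V] [Module ℂ V] (T : V →ₗ[ℂ] V) : Prop :=
  ∀ v : V, ∃ U : Submodule ℂ V, FiniteDimensional ℂ U ∧ v ∈ U ∧ ∀ u ∈ U, T u ∈ U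

/-! ### The tensor product vertex algebra `V ⊗ (R, ∂)`

`R` is a commutative `ℂ`-algebra with a derivation `∂`.  The space `V ⊗ R` is written `R ⊗[ℂ] V`,
so that it is an `R`-module in Mathlib. -/

section Tensor

variable {R : Type*} [CommRing R] [Algebra ℂ R] {V : Type*} [AddCommGroup V] [Module ℂ V]

/-- `∂ⁱ / i!`. -/
def divPow (D : Derivation ℂ R R) (i : ℕ) : R →ₗ[ℂ] R :=
  ((i ! : ℂ)⁻¹) • (D : R →ₗ[ℂ] R) ^ i

variable (R) in
/-- The `R`-bilinear extension of the modes: `(a ⊗ u, b ⊗ w) ↦ ab ⊗ uₙ w`. -/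
def scalarMode (S : VertexStructure V) (n : ℤ) :
    R ⊗[ℂ] V →ₗ[R] R ⊗[ℂ] V →ₗ[R] R ⊗[ℂ] V :=
  LinearMap.BilinMap.baseChange R (S.mode n)

theorem scalarMode_tmul (S : VertexStructure V) (n : ℤ) (a b : R) (u w : V) :
    scalarMode R S n (a ⊗ₜ u) (b ⊗ₜ w) = (a * b) ⊗ₜ S.mode n u w :=
  LinearMap.BilinMap.baseChange_tmul ..

/-- For fixed `A, B`, the products of all `(∂ⁱ/i! ⊗ 1) A` with `B` vanish for large modes. -/
theorem exists_scalarMode_eq_zero (S : VertexStructure V) (D : Derivation ℂ R R)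
    (A B : R ⊗[ℂ] V) : ∃ N : ℤ, ∀ n : ℤ, N ≤ n → ∀ i : ℕ,
      scalarMode R S n ((divPow D i).rTensor V A) B = 0 := by
  induction A using TensorProduct.induction_on with
  | zero => exact ⟨0, by simp⟩
  | add A A' hA hA' =>
    obtain ⟨N, hN⟩ := hA
    obtain ⟨N', hN'⟩ := hA'
    refine ⟨max N N', fun n hn i => ?_⟩
    rw [map_add, map_add, LinearMap.add_apply, hN n (by omega), hN' n (by omega), add_zero]
  | tmul a u =>
    induction B using TensorProduct.induction_on with
    | zero => exact ⟨0, by simp⟩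
    | add B B' hB hB' =>
      obtain ⟨N, hN⟩ := hB
      obtain ⟨N', hN'⟩ := hB'
      refine ⟨max N N', fun n hn i => ?_⟩
      rw [map_add, hN n (by omega), hN' n (by omega), add_zero]
    | tmul b w =>
      obtain ⟨N, hN⟩ := S.exists_mode_eq_zero u w
      refine ⟨N, fun n hn i => ?_⟩
      rw [LinearMap.rTensor_tmul, scalarMode_tmul, hN n hn, TensorProduct.tmul_zero]

/-- The coefficient of `x^{-n-1}` in `Y(e^{x(1 ⊗ ∂)} A, x) B`, where
`Y(u ⊗ a, x)(w ⊗ b) = Y(u, x)w ⊗ ab`.  On pure tensors this is the coefficient of `x^{-n-1}` in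
`Y_ten(u ⊗ a, x)(w ⊗ b) = Y(u, x)w ⊗ (e^{x∂}a)b`.  The sum is finite. -/
def tensorMode (S : VertexStructure V) (D : Derivation ℂ R R) (n : ℤ) (A B : R ⊗[ℂ] V) :
    R ⊗[ℂ] V :=
  ∑ᶠ i : ℕ, scalarMode R S (n + i) ((divPow D i).rTensor V A) B

theorem tensorMode_support_finite (S : VertexStructure V) (D : Derivation ℂ R R) (n : ℤ)
    (A B : R ⊗[ℂ] V) : (Function.support fun i : ℕ =>
      scalarMode R S (n + i) ((divPow D i).rTensor V A) B).Finite := by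
  obtain ⟨N, hN⟩ := exists_scalarMode_eq_zero S D A B
  refine (Set.finite_lt_nat (N - n).toNat).subset fun i hi => ?_
  by_contra h
  have h' : ¬ i < (N - n).toNat := h
  exact hi (hN _ (by omega) i)

theorem tensorMode_add_left (S : VertexStructure V) (D : Derivation ℂ R R) (n : ℤ)
    (A A' B : R ⊗[ℂ] V) :
    tensorMode S D n (A + A') B = tensorMode S D n A B + tensorMode S D n A' B := by
  simp only [tensorMode, map_add, LinearMap.add_apply]
  exact finsum_add_distrib (tensorMode_support_finite ..) (tensorMode_support_finite ..)

theorem tensorMode_add_right (S : VertexStructure V) (D : Derivation ℂ R R) (n : ℤ)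
    (A B B' : R ⊗[ℂ] V) :
    tensorMode S D n A (B + B') = tensorMode S D n A B + tensorMode S D n A B' := by
  simp only [tensorMode, map_add]
  exact finsum_add_distrib (tensorMode_support_finite ..) (tensorMode_support_finite ..)

theorem tensorMode_smul_left (S : VertexStructure V) (D : Derivation ℂ R R) (n : ℤ)
    (r : ℂ) (A B : R ⊗[ℂ] V) :
    tensorMode S D n (r • A) B = r • tensorMode S D n A B := by
  simp only [tensorMode, map_smul, LinearMap.map_smul_of_tower, LinearMap.smul_apply]
  exact (smul_finsum' r (tensorMode_support_finite ..)).symm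

theorem tensorMode_smul_right (S : VertexStructure V) (D : Derivation ℂ R R) (n : ℤ)
    (r : ℂ) (A B : R ⊗[ℂ] V) :
    tensorMode S D n A (r • B) = r • tensorMode S D n A B := by
  simp only [tensorMode, LinearMap.map_smul_of_tower]
  exact (smul_finsum' r (tensorMode_support_finite ..)).symm

/-- The operator `w ↦ Aₙ w` on `V ⊗ (R, ∂)`. -/
def tensorModeEnd (S : VertexStructure V) (D : Derivation ℂ R R) (n : ℤ) (A : R ⊗[ℂ] V) :
    Module.End ℂ (R ⊗[ℂ] V) where
  toFun := tensorMode S D n A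
  map_add' := tensorMode_add_right S D n A
  map_smul' r B := tensorMode_smul_right S D n r A B

theorem tensorModeEnd_bddBelow (S : VertexStructure V) (D : Derivation ℂ R R) (A B : R ⊗[ℂ] V) :
    BddBelow (Function.support fun k : ℤ => tensorModeEnd S D (-k - 1) A B) := by
  obtain ⟨N, hN⟩ := exists_scalarMode_eq_zero S D A B
  refine ⟨-N - 1, fun k hk => ?_⟩
  by_contra h
  exact hk (finsum_eq_zero_of_forall_eq_zero fun i => hN _ (by omega) i)

/-- `Y_ten(A, x)` as a vertex operator. -/
def tensorField (S : VertexStructure V) (D : Derivation ℂ R R) (A : R ⊗[ℂ] V) :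
    VertexOperator ℂ (R ⊗[ℂ] V) :=
  VertexOperator.of_coeff (fun k : ℤ => tensorModeEnd S D (-k - 1) A)
    (tensorModeEnd_bddBelow S D A)

theorem tensorField_coeff (S : VertexStructure V) (D : Derivation ℂ R R) (A : R ⊗[ℂ] V) :
    HVertexOperator.coeff (tensorField S D A) = fun k : ℤ => tensorModeEnd S D (-k - 1) A :=
  HVertexOperator.coeff_of_coeff ..

/-- The vacuum `𝟏 ⊗ 1` and the vertex operator map `Y_ten` of `V ⊗ (R, ∂)`. -/
def tensorStructure (S : VertexStructure V) (D : Derivation ℂ R R) :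
    VertexStructure (R ⊗[ℂ] V) where
  vacuum := 1 ⊗ₜ S.vacuum
  Y :=
    { toFun := tensorField S D
      map_add' := fun A A' => HVertexOperator.coeff_inj <| by
        rw [map_add, tensorField_coeff, tensorField_coeff, tensorField_coeff]
        exact funext fun k => LinearMap.ext fun B => tensorMode_add_left S D _ A A' B
      map_smul' := fun r A => HVertexOperator.coeff_inj <| by
        rw [map_smul, tensorField_coeff, tensorField_coeff]
        exact funext fun k => LinearMap.ext fun B => tensorMode_smul_left S D _ r A B }

theorem tensorStructure_mode (S : VertexStructure V) (D : Derivation ℂ R R) (n : ℤ)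
    (A B : R ⊗[ℂ] V) : (tensorStructure S D).mode n A B = tensorMode S D n A B := by
  have h : (tensorStructure S D).mode n A B =
      HVertexOperator.coeff (tensorField S D A) (-n - 1) B := rfl
  have e : -(-n - 1) - 1 = n := by ring
  rw [h, tensorField_coeff]
  beta_reduce
  rw [e]
  rfl

/-! ### Pseudo-endomorphisms, pseudo-automorphisms and exponentials -/

/-- An `R`-valued pseudo-endomorphism `Δ ∈ Hom(V, V ⊗ R)`: `Δ(𝟏) = 𝟏 ⊗ 1` and
`Δ Y(u, x) w = Y(e^{x(1 ⊗ ∂)} Δ(u), x) Δ(w)`. -/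
structure IsPseudoEndomorphism (S : VertexStructure V) (D : Derivation ℂ R R)
    (Δ : V →ₗ[ℂ] R ⊗[ℂ] V) : Prop where
  map_vacuum : Δ S.vacuum = 1 ⊗ₜ S.vacuum
  map_mode : ∀ (n : ℤ) (u w : V), Δ (S.mode n u w) = tensorMode S D n (Δ u) (Δ w)

/-- A pseudo-automorphism: a pseudo-endomorphism whose `R`-linear extension is an automorphism of
`V ⊗ (R, ∂)`. -/
structure IsPseudoAutomorphism (S : VertexStructure V) (D : Derivation ℂ R R)
    (Δ : V →ₗ[ℂ] R ⊗[ℂ] V) : Prop extends IsPseudoEndomorphism S D Δ where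
  isAutomorphism : (tensorStructure S D).IsAutomorphism
    ((LinearMap.liftBaseChange R Δ).restrictScalars ℂ)

/-- `X_{v,f} = ∑_{n ≥ 0} (1/n!) (∂ⁿ f) vₙ`, as an element of `Hom(V, V ⊗ R)`. -/
def pseudoX (S : VertexStructure V) (D : Derivation ℂ R R) (v : V) (f : R) :
    V →ₗ[ℂ] R ⊗[ℂ] V where
  toFun w := ∑ᶠ n : ℕ, divPow D n f ⊗ₜ[ℂ] S.mode n v w
  map_add' w w' := by
    have fin : ∀ w : V,
        (Function.support fun n : ℕ => divPow D n f ⊗ₜ[ℂ] S.mode n v w).Finite := fun w => by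
      obtain ⟨N, hN⟩ := S.exists_mode_eq_zero v w
      refine (Set.finite_lt_nat N.toNat).subset fun n hn => ?_
      by_contra h
      have h' : ¬ n < N.toNat := h
      exact hn (by simp [hN n (by omega)])
    simp only [map_add, TensorProduct.tmul_add]
    exact finsum_add_distrib (fin w) (fin w')
  map_smul' r w := by
    have fin : (Function.support fun n : ℕ => divPow D n f ⊗ₜ[ℂ] S.mode n v w).Finite := by
      obtain ⟨N, hN⟩ := S.exists_mode_eq_zero v w
      refine (Set.finite_lt_nat N.toNat).subset fun n hn => ?_
      by_contra h
      have h' : ¬ n < N.toNat := h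
      exact hn (by simp [hN n (by omega)])
    simp only [map_smul, TensorProduct.tmul_smul, RingHom.id_apply]
    exact (smul_finsum' r fin).symm

/-- `E = exp Φ` in `Hom(V, V ⊗ R)`: for every `v`, the series `∑ₙ (1/n!) Φⁿ(v)`, with `Φ` extended
`R`-linearly to `V ⊗ R`, converges to `E v` in the `I`-adic topology. -/
def IsExp (I : Ideal R) (Φ E : V →ₗ[ℂ] R ⊗[ℂ] V) : Prop :=
  ∀ (v : V) (N : ℕ), ∃ n₀ : ℕ, ∀ n : ℕ, n₀ ≤ n →
    (∑ j ∈ Finset.range n,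
      ((j ! : ℂ)⁻¹) • (LinearMap.liftBaseChange R Φ ^ j : Module.End R (R ⊗[ℂ] V)) (1 ⊗ₜ v)) - E v
      ∈ (I ^ N • ⊤ : Submodule R (R ⊗[ℂ] V))

end Tensor

/-! ### The coefficient algebras `ℂ[z⁻¹] ⊗ ℂ[[y]]` and `ℂ[z⁻¹] ⊗ K_r[y]`

The variable of `Polynomial ℂ` is `z⁻¹`, that of `PowerSeries ℂ` is `y`. -/

section Coefficients

variable {K : Type*} [CommRing K] [Algebra ℂ K]

/-- `d/dz` on `ℂ[z⁻¹]`; with `t = z⁻¹` it is `-t² d/dt`. -/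
def dz : Derivation ℂ (Polynomial ℂ) (Polynomial ℂ) :=
  (-(Polynomial.X ^ 2 : Polynomial ℂ)) • Polynomial.derivative'

/-- For a derivation `d` (playing the role of `d/dy`) of `K`, the derivation
`∂ = d/dz ⊗ 1 + z⁻¹ ⊗ d` of `ℂ[z⁻¹] ⊗ K`. -/
def del (d : Derivation ℂ K K) :
    Derivation ℂ (Polynomial ℂ ⊗[ℂ] K) (Polynomial ℂ ⊗[ℂ] K) :=
  Derivation.mk'
    (TensorProduct.map (dz : Polynomial ℂ →ₗ[ℂ] Polynomial ℂ) LinearMap.id +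
      TensorProduct.map (LinearMap.mulLeft ℂ Polynomial.X) (d : K →ₗ[ℂ] K))
    (fun a b => by
      induction a using TensorProduct.induction_on with
      | zero => simp
      | add a a' ha ha' => rw [add_mul, map_add, ha, ha', map_add]; simp only [smul_eq_mul]; ring
      | tmul p f =>
        induction b using TensorProduct.induction_on with
        | zero => simp
        | add b b' hb hb' => rw [mul_add, map_add, hb, hb', map_add]; simp only [smul_eq_mul]; ring
        | tmul q g =>
          simp only [Algebra.TensorProduct.tmul_mul_tmul, LinearMap.add_apply,
            TensorProduct.map_tmul, LinearMap.id_apply, LinearMap.mulLeft_apply,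
            Derivation.coeFn_coe, Derivation.leibniz, smul_eq_mul, mul_add, TensorProduct.tmul_add,
            TensorProduct.add_tmul]
          have e1 : Polynomial.X * (p * q) = p * (Polynomial.X * q) := by ring
          have e2 : q * (Polynomial.X * p) = Polynomial.X * (p * q) := by ring
          rw [e2, ← e1, mul_comm g f]
          abel)

/-- `K_r[y]`, the subalgebra of `ℂ[[y]]` generated by `y` and `e^{αy}`, `α ∈ (1/r)ℤ`. -/
def Kr (r : ℕ) : Subalgebra ℂ (PowerSeries ℂ) :=
  Algebra.adjoin ℂ (insert PowerSeries.X
    (Set.range fun k : ℤ => PowerSeries.rescale ((k : ℂ) / r) (PowerSeries.exp ℂ)))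

theorem derivative_mem_Kr (r : ℕ) {f : PowerSeries ℂ} (hf : f ∈ Kr r) :
    PowerSeries.derivative ℂ f ∈ Kr r := by
  unfold Kr at hf
  induction hf using Algebra.adjoin_induction with
  | mem x hx =>
    rcases hx with rfl | ⟨k, rfl⟩
    · rw [PowerSeries.derivative_X]; exact one_mem (Kr r)
    · have h : ∀ c : ℂ, PowerSeries.derivative ℂ (PowerSeries.rescale c (PowerSeries.exp ℂ)) =
          c • PowerSeries.rescale c (PowerSeries.exp ℂ) := by
        intro c
        ext n
        have h1 : ((n : ℂ) + 1) ≠ 0 := by exact_mod_cast Nat.succ_ne_zero n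
        have h2 : ((n ! : ℕ) : ℂ) ≠ 0 := by exact_mod_cast Nat.factorial_ne_zero n
        simp [PowerSeries.coeff_derivative, PowerSeries.coeff_rescale, PowerSeries.coeff_exp,
          Nat.factorial_succ]
        field_simp
        ring
      dsimp only
      rw [h]
      exact (Kr r).smul_mem (Algebra.subset_adjoin (Or.inr ⟨k, rfl⟩)) _
  | algebraMap c => rw [Derivation.map_algebraMap]; exact zero_mem (Kr r)
  | add f g _ _ hf hg => rw [map_add]; exact add_mem hf hg
  | mul f g hf' hg' hf hg =>
    rw [Derivation.leibniz]
    exact add_mem (mul_mem hf' hg) (mul_mem hg' hf)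

/-- `d/dy` on `K_r[y]`. -/
def derivKr (r : ℕ) : Derivation ℂ (Kr r) (Kr r) :=
  Derivation.mk'
    ((PowerSeries.derivative ℂ : PowerSeries ℂ →ₗ[ℂ] PowerSeries ℂ).restrict
      (p := Subalgebra.toSubmodule (Kr r)) (q := Subalgebra.toSubmodule (Kr r))
      fun _ hf => derivative_mem_Kr r hf)
    (fun a b => Subtype.ext ((PowerSeries.derivative ℂ).leibniz (a : PowerSeries ℂ) b))

/-- The algebra `ℂ[z⁻¹] ⊗ ℂ[[y]]`. -/
abbrev RY : Type := Polynomial ℂ ⊗[ℂ] PowerSeries ℂ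

/-- `∂` on `ℂ[z⁻¹] ⊗ ℂ[[y]]`: it restricts to `d/dz` on `ℂ[z⁻¹]` and satisfies `∂y = z⁻¹`. -/
def delY : Derivation ℂ RY RY := del (PowerSeries.derivative ℂ)

/-- The element `y` of `ℂ[z⁻¹] ⊗ ℂ[[y]]`. -/
def yY : RY := 1 ⊗ₜ PowerSeries.X

/-- The algebra `ℂ[z⁻¹] ⊗ K_r[y]`. -/
abbrev RK (r : ℕ) : Type := Polynomial ℂ ⊗[ℂ] Kr r

/-- `∂` on `ℂ[z⁻¹] ⊗ K_r[y]`. -/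
def delK (r : ℕ) : Derivation ℂ (RK r) (RK r) := del (derivKr r)

/-- The inclusion of `ℂ[z⁻¹] ⊗ K_r[y]` into `ℂ[z⁻¹] ⊗ ℂ[[y]]`. -/
def inclK (r : ℕ) : RK r →ₐ[ℂ] RY :=
  Algebra.TensorProduct.map (AlgHom.id ℂ (Polynomial ℂ)) (Kr r).val

end Coefficients

end PseudoEnd

end

noncomputable section

namespace PseudoEnd

open Finset.HasAntidiagonal (antidiagonal)

/-! ### Divided powers of operators -/

/-! Let X be the R-linear extension of X_{h,y} to V ⊗ R. The argument rests on three facts.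

X is a derivation of every product A_n B of V ⊗ (R, ∂) (`liftBaseChange_pseudoX_tensorMode`). This
is the commutator formula [h_m, u_n] = ∑ C(m,j) (h_j u)_{m+n-j}, whose binomial coefficients are
exactly those in the product of the divided powers ∂^i/i! and ∂^j/j!. Hence exp X is formally an
automorphism, with inverse exp(-X).

X differs from a scalar by a nilpotent operator on suitable vectors
(`pow_liftBaseChange_pseudoX_sub_eq_zero`). On a generalized eigenvector v of h_0 with eigenvalue α,
put Z = X - αy. The operator h_0 - α is nilpotent on v, while for n ≥ 1 the operator h_n lowers the
weight by n and commutes with h_0; since weights are bounded below, Z^c v = 0 for some c. So exp X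
converges on v to e^{αy} ∑_{l<c} Z^l v / l!, with j-th term divisible by y^{j-c}. Local finiteness
of h_0 writes every vector as a sum of such v.

The limit commutes with the products (`expConverges_tensorMode`). The delicate point is that A_n B =
∑_i ((∂^i/i!) A)_{n+i} B, where the right-hand products are R-bilinear, is not obviously y-adically
continuous in A: each ∂ may cost a power of y. But X preserves the weight filtration, so all terms
of both exponential series lie in fixed filtration steps, and there the sum over i stops at a bound
independent of the terms. The loss of powers of y is therefore bounded.

The explicit limit also gives the statement about K_r[y]: it involves only e^{αy}, y and X, all of
which preserve V ⊗ ℂ[z⁻¹] ⊗ K_r[y] when α is an eigenvalue. The identities then descend along an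
injective inclusion commuting with ∂. -/

/-- If `f i j` lies in `J` whenever `a ≤ i + j`, the sums of `f` over the rectangle
`[0, a) × [0, b)` and over the triangle `i + j < a` agree modulo `J`. -/
theorem sum_rectangle_sub_sum_triangle_mem {G : Type*} [AddCommGroup G] (J : AddSubgroup G)
    (f : ℕ → ℕ → G) {a b : ℕ} (hab : a ≤ b) (hf : ∀ i j, a ≤ i + j → f i j ∈ J) :
    ∑ i ∈ Finset.range a, ∑ j ∈ Finset.range b, f i j -
      ∑ k ∈ Finset.range a, ∑ p ∈ antidiagonal k, f p.1 p.2 ∈ J := by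
  have e : ∑ k ∈ Finset.range a, ∑ p ∈ antidiagonal k, f p.1 p.2 =
      ∑ i ∈ Finset.range a, ∑ j ∈ Finset.range (a - i), f i j := by
    rw [← Finset.sum_range_diag_flip]
    exact Finset.sum_congr rfl fun k _ =>
      Finset.Nat.sum_antidiagonal_eq_sum_range_succ (fun i j => f i j) k
  rw [e, ← Finset.sum_sub_distrib]
  refine J.sum_mem fun i hi => ?_
  rw [← Finset.sum_Ico_eq_sub _ (by omega : a - i ≤ b)]
  refine J.sum_mem fun j hj => hf i j ?_
  have := (Finset.mem_Ico.1 hj).1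
  omega

theorem sum_rectangle_eq_sum_triangle {G : Type*} [AddCommGroup G]
    (f : ℕ → ℕ → G) {a b : ℕ} (hab : a ≤ b) (hf : ∀ i j, a ≤ i + j → f i j = 0) :
    ∑ i ∈ Finset.range a, ∑ j ∈ Finset.range b, f i j =
      ∑ k ∈ Finset.range a, ∑ p ∈ antidiagonal k, f p.1 p.2 := by
  simpa [sub_eq_zero] using sum_rectangle_sub_sum_triangle_mem ⊥ f hab
    fun i j h => AddSubgroup.mem_bot.2 (hf i j h)

section DividedPower

variable {M : Type*} [AddCommGroup M] [Module ℂ M] {M' : Type*} [AddCommGroup M'] [Module ℂ M']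
  {M'' : Type*} [AddCommGroup M''] [Module ℂ M'']

/-- `Xʲ / j!`. -/
def expTerm (X : Module.End ℂ M) (j : ℕ) : Module.End ℂ M := ((j ! : ℂ)⁻¹) • X ^ j

theorem inv_factorial_mul_choose {j : ℕ} {p : ℕ × ℕ} (hp : p ∈ antidiagonal j) :
    ((j ! : ℂ)⁻¹) * (j.choose p.1 : ℂ) = ((p.1 ! : ℂ)⁻¹) * ((p.2 ! : ℂ)⁻¹) := by
  obtain rfl := Finset.HasAntidiagonal.mem_antidiagonal.1 hp
  have h := Nat.add_choose_mul_factorial_mul_factorial p.1 p.2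
  have h' : (((p.1 + p.2).choose p.1 : ℕ) : ℂ) * (p.1 ! : ℕ) * (p.2 ! : ℕ) =
      ((p.1 + p.2)! : ℕ) := by
    rw [Nat.choose_symm_add]; exact_mod_cast h
  have h1 : ((p.1 ! : ℕ) : ℂ) ≠ 0 := by exact_mod_cast Nat.factorial_ne_zero _
  have h2 : ((p.2 ! : ℕ) : ℂ) ≠ 0 := by exact_mod_cast Nat.factorial_ne_zero _
  have h3 : (((p.1 + p.2)! : ℕ) : ℂ) ≠ 0 := by exact_mod_cast Nat.factorial_ne_zero _
  field_simp
  rw [← h']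

theorem expTerm_zero (X : Module.End ℂ M) : expTerm X 0 = 1 := by simp [expTerm]

theorem expTerm_mul (X : Module.End ℂ M) (i j : ℕ) :
    expTerm X i * expTerm X j = ((i + j).choose i : ℂ) • expTerm X (i + j) := by
  have h := inv_factorial_mul_choose (p := (i, j)) (j := i + j) (by simp)
  rw [expTerm, expTerm, expTerm, smul_mul_smul_comm, ← pow_add, smul_smul, ← h, mul_comm]

theorem expTerm_add {X Z : Module.End ℂ M} (h : Commute X Z) (j : ℕ) :
    expTerm (X + Z) j = ∑ p ∈ antidiagonal j, expTerm X p.1 * expTerm Z p.2 := by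
  rw [expTerm, h.add_pow', Finset.smul_sum]
  refine Finset.sum_congr rfl fun p hp => ?_
  rw [expTerm, expTerm, smul_mul_smul_comm, ← inv_factorial_mul_choose hp, mul_smul,
    Nat.cast_smul_eq_nsmul]

theorem expTerm_bilin (T : M →ₗ[ℂ] M' →ₗ[ℂ] M'') (X : Module.End ℂ M) (X' : Module.End ℂ M')
    (X'' : Module.End ℂ M'') (h : ∀ a b, X'' (T a b) = T (X a) b + T a (X' b)) (j : ℕ)
    (a : M) (b : M') : expTerm X'' j (T a b) =
      ∑ p ∈ antidiagonal j, T (expTerm X p.1 a) (expTerm X' p.2 b) := by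
  have hc : Commute (X.rTensor M' : Module.End ℂ (M ⊗[ℂ] M')) (X'.lTensor M) := by
    rw [commute_iff_eq, Module.End.mul_eq_comp, Module.End.mul_eq_comp,
      LinearMap.rTensor_comp_lTensor, LinearMap.lTensor_comp_rTensor]
  have hT : ∀ t : M ⊗[ℂ] M', X'' (TensorProduct.lift T t) =
      TensorProduct.lift T ((X.rTensor M' + X'.lTensor M : Module.End ℂ (M ⊗[ℂ] M')) t) := by
    intro t
    induction t using TensorProduct.induction_on with
    | zero => simp
    | add x y hx hy => simp only [map_add, hx, hy]
    | tmul a b => simp [h]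
  have hpow : ∀ (n : ℕ) (t : M ⊗[ℂ] M'), (X'' ^ n) (TensorProduct.lift T t) =
      TensorProduct.lift T (((X.rTensor M' + X'.lTensor M : Module.End ℂ (M ⊗[ℂ] M')) ^ n) t) := by
    intro n
    induction n with
    | zero => intro t; rfl
    | succ n ih =>
      intro t
      rw [pow_succ, pow_succ, Module.End.mul_apply, Module.End.mul_apply, hT, ih]
  have key : expTerm X'' j (TensorProduct.lift T (a ⊗ₜ b)) = TensorProduct.lift T
      (expTerm (X.rTensor M' + X'.lTensor M : Module.End ℂ (M ⊗[ℂ] M')) j (a ⊗ₜ b)) := by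
    rw [expTerm, expTerm, LinearMap.smul_apply, LinearMap.smul_apply, hpow, map_smul]
  rw [TensorProduct.lift.tmul] at key
  rw [key, expTerm_add hc, LinearMap.sum_apply, map_sum]
  refine Finset.sum_congr rfl fun p _ => ?_
  rw [expTerm, expTerm, expTerm, expTerm, LinearMap.rTensor_pow, LinearMap.lTensor_pow]
  simp

end DividedPower

/-! ### Modes of the tensor product vertex algebra -/

section Modes

variable {R : Type*} [CommRing R] [Algebra ℂ R] {V : Type*} [AddCommGroup V] [Module ℂ V]

theorem divPow_zero_apply (D : Derivation ℂ R R) (a : R) : divPow D 0 a = a := by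
  simp [divPow]

theorem divPow_one_of_pos (D : Derivation ℂ R R) {i : ℕ} (hi : 0 < i) :
    divPow D i (1 : R) = 0 := by
  obtain ⟨j, rfl⟩ := Nat.exists_eq_succ_of_ne_zero hi.ne'
  have : (D : R →ₗ[ℂ] R) 1 = 0 := D.map_one_eq_zero
  rw [divPow, LinearMap.smul_apply, pow_succ, Module.End.mul_apply, this, map_zero, smul_zero]

theorem divPow_divPow (D : Derivation ℂ R R) (i j : ℕ) (a : R) :
    divPow D i (divPow D j a) = ((i + j).choose i : ℂ) • divPow D (i + j) a := by
  exact congrArg (fun f : Module.End ℂ R => f a) (expTerm_mul (D : R →ₗ[ℂ] R) i j)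

theorem rTensor_divPow (D : Derivation ℂ R R) (i : ℕ) :
    (divPow D i).rTensor V = expTerm ((D : R →ₗ[ℂ] R).rTensor V) i := by
  rw [divPow, expTerm, LinearMap.rTensor_smul, LinearMap.rTensor_pow]

theorem rTensor_divPow_smul (D : Derivation ℂ R R) (j : ℕ) (a : R) (A : R ⊗[ℂ] V) :
    (divPow D j).rTensor V (a • A) =
      ∑ p ∈ antidiagonal j, divPow D p.1 a • (divPow D p.2).rTensor V A := by
  simp only [rTensor_divPow]
  refine expTerm_bilin (LinearMap.restrictScalars₁₂ ℂ ℂ (LinearMap.lsmul R (R ⊗[ℂ] V)))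
    (D : R →ₗ[ℂ] R) ((D : R →ₗ[ℂ] R).rTensor V) ((D : R →ₗ[ℂ] R).rTensor V) (fun r B => ?_) j a A
  simp only [LinearMap.restrictScalars₁₂_apply_apply, LinearMap.lsmul_apply, Derivation.coeFn_coe]
  induction B using TensorProduct.induction_on with
  | zero => simp
  | add B B' hB hB' => simp only [smul_add, map_add, hB, hB']; abel
  | tmul s v =>
    simp only [TensorProduct.smul_tmul', smul_eq_mul, LinearMap.rTensor_tmul, Derivation.coeFn_coe,
      Derivation.leibniz, TensorProduct.add_tmul]
    rw [add_comm, mul_comm s]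

theorem tensorMode_eq_sum (S : VertexStructure V) (D : Derivation ℂ R R) {n : ℤ}
    {A B : R ⊗[ℂ] V} {N : ℕ}
    (h : ∀ i : ℕ, N ≤ i → scalarMode R S (n + i) ((divPow D i).rTensor V A) B = 0) :
    tensorMode S D n A B =
      ∑ i ∈ Finset.range N, scalarMode R S (n + i) ((divPow D i).rTensor V A) B := by
  refine finsum_eq_sum_of_support_subset _ fun i hi => ?_
  by_contra h'
  exact hi (h i (by simpa using h'))

theorem tensorMode_smul_right' (S : VertexStructure V) (D : Derivation ℂ R R) (n : ℤ)
    (b : R) (A B : R ⊗[ℂ] V) : tensorMode S D n A (b • B) = b • tensorMode S D n A B := by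
  simp only [tensorMode, map_smul]
  exact (smul_finsum' b (tensorMode_support_finite ..)).symm

/-- This is e^{x∂}(aA) = (e^{x∂}a)(e^{x∂}A), read off mode by mode. The truncation depends on A and
B but not on a, and any larger one works, so several such expansions can share one. -/
theorem exists_tensorMode_smul_left (S : VertexStructure V) (D : Derivation ℂ R R) (n : ℤ)
    (A B : R ⊗[ℂ] V) : ∃ N : ℕ, ∀ M : ℕ, N ≤ M → ∀ a : R, tensorMode S D n (a • A) B =
      ∑ i ∈ Finset.range M, divPow D i a • tensorMode S D (n + i) A B := by
  obtain ⟨N, hN⟩ := exists_scalarMode_eq_zero S D A B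
  refine ⟨(N - n).toNat, fun M hM a => ?_⟩
  have e : ∀ i : ℕ, scalarMode R S (n + i) ((divPow D i).rTensor V (a • A)) B =
      ∑ p ∈ antidiagonal i, divPow D p.1 a •
        scalarMode R S (n + p.1 + p.2) ((divPow D p.2).rTensor V A) B := by
    intro i
    rw [rTensor_divPow_smul, map_sum, LinearMap.sum_apply]
    refine Finset.sum_congr rfl fun p hp => ?_
    obtain rfl := Finset.HasAntidiagonal.mem_antidiagonal.1 hp
    rw [map_smul, LinearMap.smul_apply, Nat.cast_add, add_assoc]
  rw [tensorMode_eq_sum (N := M), Finset.sum_congr rfl fun i _ => e i,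
    ← sum_rectangle_eq_sum_triangle (fun i j => divPow D i a •
        scalarMode R S (n + i + j) ((divPow D j).rTensor V A) B) le_rfl]
  · refine Finset.sum_congr rfl fun i _ => ?_
    rw [tensorMode_eq_sum (N := M), Finset.smul_sum]
    intro j hj
    exact hN _ (by omega) _
  · intro i j hij
    rw [hN _ (by omega), smul_zero]
  · intro i hi
    rw [e]
    refine Finset.sum_eq_zero fun p hp => ?_
    have := Finset.HasAntidiagonal.mem_antidiagonal.1 hp
    rw [hN _ (by omega), smul_zero]

theorem tensorMode_one_tmul (S : VertexStructure V) (D : Derivation ℂ R R) (n : ℤ)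
    (u : V) (B : R ⊗[ℂ] V) : tensorMode S D n (1 ⊗ₜ u) B = scalarMode R S n (1 ⊗ₜ u) B := by
  rw [tensorMode_eq_sum (N := 1)]
  · simp [divPow_zero_apply]
  · intro i hi
    rw [LinearMap.rTensor_tmul, divPow_one_of_pos D (by omega), TensorProduct.zero_tmul, map_zero,
      LinearMap.zero_apply]

theorem exists_pseudoX_eq_sum (S : VertexStructure V) (D : Derivation ℂ R R) (v : V) (f : R)
    (w : V) : ∃ N : ℕ, (∀ n : ℕ, N ≤ n → S.mode n v w = 0) ∧ ∀ M : ℕ, N ≤ M →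
      pseudoX S D v f w = ∑ n ∈ Finset.range M, divPow D n f ⊗ₜ[ℂ] S.mode n v w := by
  obtain ⟨N, hN⟩ := S.exists_mode_eq_zero v w
  refine ⟨N.toNat, fun n hn => hN _ (by omega), fun M hM => ?_⟩
  refine finsum_eq_sum_of_support_subset _ fun i hi => ?_
  by_contra h'
  have : ¬ i < M := by simpa using h'
  exact hi (by simp [hN i (by omega)])

/-- The Jacobi identity at l = 0, where C(0,i) leaves only i = 0 on the right. Indexing by the
antidiagonal, with C(m,j) = C(m,m-j), prepares the comparison with divided powers of ∂. -/
theorem VertexAlgebra.commutator (S : VertexAlgebra V) (m : ℕ) (n : ℤ) (h u w : V) :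
    S.mode m h (S.mode n u w) - S.mode n u (S.mode m h w) =
      ∑ p ∈ antidiagonal m,
        (m.choose p.1 : ℂ) • S.mode (n + p.1) (S.mode p.2 h u) w := by
  have hj := S.jacobi 0 m n h u w
  rw [finsum_eq_single (fun i : ℕ => ((-1 : ℤ) ^ i * Ring.choose (0 : ℤ) i) • _) 0] at hj
  · simp only [pow_zero, Ring.choose_zero_right, mul_one, one_smul, Int.negOnePow_zero,
      Units.val_one, Nat.cast_zero, sub_zero, add_zero] at hj
    rw [← hj, finsum_eq_sum_of_support_subset (s := Finset.range (m + 1)),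
      ← Finset.Nat.sum_antidiagonal_swap,
      Finset.Nat.sum_antidiagonal_eq_sum_range_succ_mk]
    · refine Finset.sum_congr rfl fun i hi => ?_
      have hi' : i ≤ m := by have := Finset.mem_range.1 hi; omega
      have e : (n + ((m - i : ℕ) : ℤ)) = (m : ℤ) + n - i := by omega
      simp only [Prod.swap]
      rw [e, Nat.choose_symm hi', zero_add, Ring.choose_natCast, natCast_zsmul,
        Nat.cast_smul_eq_nsmul]
    · intro i hi
      by_contra h'
      refine hi ?_
      have : m < i := by simpa using h'
      simp [Ring.choose_natCast, Nat.choose_eq_zero_of_lt this]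
  · intro i hi
    have : Ring.choose (0 : ℤ) i = 0 := by
      have := Ring.choose_natCast (R := ℤ) 0 i
      rw [Nat.cast_zero] at this
      rw [this, Nat.choose_eq_zero_of_lt (by omega), Nat.cast_zero]
    simp [this]

/-- `X_{v,f}` satisfies the Leibniz rule for `1 ⊗ u` and `1 ⊗ w`. -/
theorem pseudoX_mode (S : VertexAlgebra V) (D : Derivation ℂ R R) (h : V) (f : R) (n : ℤ)
    (u w : V) : pseudoX S.toVertexStructure D h f (S.mode n u w) =
      tensorMode S.toVertexStructure D n (pseudoX S.toVertexStructure D h f u) (1 ⊗ₜ w) +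
        tensorMode S.toVertexStructure D n (1 ⊗ₜ u) (pseudoX S.toVertexStructure D h f w) := by
  obtain ⟨N₁, h₁, hu⟩ := exists_pseudoX_eq_sum S.toVertexStructure D h f u
  obtain ⟨N₂, -, hw⟩ := exists_pseudoX_eq_sum S.toVertexStructure D h f w
  obtain ⟨N₃, -, hn⟩ := exists_pseudoX_eq_sum S.toVertexStructure D h f (S.mode n u w)
  -- The bound is uniform in j because h_j u is nonzero only for the finitely many j < N₁.
  have hK : ∃ K : ℕ, ∀ i j : ℕ, K ≤ i → S.mode (n + i) (S.mode j h u) w = 0 := by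
    choose K hK using fun j : ℕ => S.exists_mode_eq_zero (S.mode j h u) w
    refine ⟨(Finset.range N₁).sup fun j => (K j - n).toNat, fun i j hi => ?_⟩
    by_cases hj : N₁ ≤ j
    · rw [h₁ j hj, map_zero, LinearMap.zero_apply]
    · have := (Finset.le_sup (f := fun j => (K j - n).toNat)
        (Finset.mem_range.2 (not_le.1 hj))).trans hi
      exact hK j _ (by omega)
  obtain ⟨K, hK⟩ := hK
  set M := N₁ + N₂ + N₃ + K with hM
  have hzero : ∀ i j : ℕ, M ≤ i + j → S.mode (n + i) (S.mode j h u) w = 0 := by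
    intro i j hij
    by_cases hj : N₁ ≤ j
    · rw [h₁ j hj, map_zero, LinearMap.zero_apply]
    · exact hK i j (by omega)
  have e1 : tensorMode S.toVertexStructure D n (pseudoX S.toVertexStructure D h f u) (1 ⊗ₜ w) =
      ∑ i ∈ Finset.range M, ∑ j ∈ Finset.range M,
        divPow D i (divPow D j f) ⊗ₜ[ℂ] S.mode (n + i) (S.mode j h u) w := by
    have e : ∀ i : ℕ, scalarMode R S.toVertexStructure (n + i)
        ((divPow D i).rTensor V (pseudoX S.toVertexStructure D h f u)) (1 ⊗ₜ w) =
          ∑ j ∈ Finset.range M,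
            divPow D i (divPow D j f) ⊗ₜ[ℂ] S.mode (n + i) (S.mode j h u) w := by
      intro i
      rw [hu M (by omega), map_sum, map_sum, LinearMap.sum_apply]
      refine Finset.sum_congr rfl fun j _ => ?_
      rw [LinearMap.rTensor_tmul, scalarMode_tmul, mul_one]
    rw [tensorMode_eq_sum (N := M)]
    · exact Finset.sum_congr rfl fun i _ => e i
    · intro i hi
      rw [e]
      refine Finset.sum_eq_zero fun j _ => ?_
      rw [hzero i j (by omega), TensorProduct.tmul_zero]
  rw [e1, sum_rectangle_eq_sum_triangle (fun i j =>
      divPow D i (divPow D j f) ⊗ₜ[ℂ] S.mode (n + i) (S.mode j h u) w) le_rfl,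
    tensorMode_one_tmul, hw M (by omega), hn M (by omega), map_sum, ← Finset.sum_add_distrib]
  · refine Finset.sum_congr rfl fun m _ => ?_
    rw [scalarMode_tmul, one_mul, ← sub_eq_iff_eq_add, ← TensorProduct.tmul_sub, S.commutator,
      TensorProduct.tmul_sum]
    refine Finset.sum_congr rfl fun p hp => ?_
    -- Composing the divided powers produces exactly the binomial coefficient of the commutator
    -- formula.
    rw [divPow_divPow, Finset.HasAntidiagonal.mem_antidiagonal.1 hp, TensorProduct.smul_tmul]
  · intro i j hij
    rw [hzero i j hij, TensorProduct.tmul_zero]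

/-- The `R`-linear extension of `X_{v,f}` is a derivation of every product of `V ⊗ (R, ∂)`. -/
theorem liftBaseChange_pseudoX_tensorMode (S : VertexAlgebra V) (D : Derivation ℂ R R) (h : V)
    (f : R) (n : ℤ) (A B : R ⊗[ℂ] V) :
    LinearMap.liftBaseChange R (pseudoX S.toVertexStructure D h f)
        (tensorMode S.toVertexStructure D n A B) =
      tensorMode S.toVertexStructure D n
          (LinearMap.liftBaseChange R (pseudoX S.toVertexStructure D h f) A) B +
        tensorMode S.toVertexStructure D n A
          (LinearMap.liftBaseChange R (pseudoX S.toVertexStructure D h f) B) := by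
  set X := LinearMap.liftBaseChange R (pseudoX S.toVertexStructure D h f) with hX
  have zl : ∀ B, tensorMode S.toVertexStructure D n 0 B = 0 := fun B => by
    simpa using tensorMode_smul_left S.toVertexStructure D n 0 0 B
  have zr : ∀ A, tensorMode S.toVertexStructure D n A 0 = 0 := fun A => by
    simpa using tensorMode_smul_right S.toVertexStructure D n 0 A 0
  have one_one : ∀ (n : ℤ) (u w : V), X (tensorMode S.toVertexStructure D n (1 ⊗ₜ u) (1 ⊗ₜ w)) =
      tensorMode S.toVertexStructure D n (X (1 ⊗ₜ u)) (1 ⊗ₜ w) +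
        tensorMode S.toVertexStructure D n (1 ⊗ₜ u) (X (1 ⊗ₜ w)) := by
    intro n u w
    rw [tensorMode_one_tmul, scalarMode_tmul, hX, LinearMap.liftBaseChange_tmul,
      LinearMap.liftBaseChange_tmul, LinearMap.liftBaseChange_tmul, one_mul, one_smul, one_smul,
      one_smul, pseudoX_mode]
  induction A using TensorProduct.induction_on with
  | zero => rw [map_zero, zl, zl, map_zero, add_zero]
  | add A A' hA hA' =>
    rw [map_add, tensorMode_add_left, tensorMode_add_left, tensorMode_add_left, map_add, hA, hA']
    abel
  | tmul a u =>
    induction B using TensorProduct.induction_on with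
    | zero => rw [map_zero, zr, zr, map_zero, add_zero]
    | add B B' hB hB' =>
      rw [map_add, tensorMode_add_right, tensorMode_add_right, tensorMode_add_right, map_add, hB,
        hB']
      abel
    | tmul b w =>
      have ea : a ⊗ₜ[ℂ] u = a • (1 ⊗ₜ[ℂ] u : R ⊗[ℂ] V) := by simp [TensorProduct.smul_tmul']
      have eb : b ⊗ₜ[ℂ] w = b • (1 ⊗ₜ[ℂ] w : R ⊗[ℂ] V) := by simp [TensorProduct.smul_tmul']
      rw [ea, eb, map_smul, map_smul, tensorMode_smul_right', tensorMode_smul_right',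
        tensorMode_smul_right', map_smul, ← smul_add]
      congr 1
      -- The product is R-linear in its second argument, which disposes of b. It is not so in the
      -- first: a is moved out through its divided derivatives, leaving the case of 1 ⊗ u and 1 ⊗ w
      -- for the modes n + i.
      obtain ⟨N₁, h₁⟩ := exists_tensorMode_smul_left S.toVertexStructure D n (1 ⊗ₜ u) (1 ⊗ₜ w)
      obtain ⟨N₂, h₂⟩ := exists_tensorMode_smul_left S.toVertexStructure D n (X (1 ⊗ₜ u)) (1 ⊗ₜ w)
      obtain ⟨N₃, h₃⟩ := exists_tensorMode_smul_left S.toVertexStructure D n (1 ⊗ₜ u) (X (1 ⊗ₜ w))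
      rw [h₁ (N₁ + N₂ + N₃) (by omega), h₂ (N₁ + N₂ + N₃) (by omega),
        h₃ (N₁ + N₂ + N₃) (by omega), map_sum, ← Finset.sum_add_distrib]
      refine Finset.sum_congr rfl fun i _ => ?_
      rw [map_smul, one_one, smul_add]

end Modes

/-! ### The weight filtration -/

section Weights

variable {V : Type*} [AddCommGroup V] [Module ℂ V] (S : VertexOperatorAlgebra V)

namespace VertexOperatorAlgebra

/-- The commutator formula for ω gives [L(0), u_n] = (L(0)u)_n + (L(-1)u)_{n+1}, and the last term
is -(n+1)u_n by the L(-1)-derivative property. -/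
theorem mode_mem_weightSpace {p q : ℤ} {u w : V} (hu : u ∈ S.weightSpace p)
    (hw : w ∈ S.weightSpace q) (n : ℤ) : S.mode n u w ∈ S.weightSpace (p + q - n - 1) := by
  have hu' : S.mode 1 S.ω u = (p : ℂ) • u := Module.End.mem_eigenspace_iff.1 hu
  have hw' : S.mode 1 S.ω w = (q : ℂ) • w := Module.End.mem_eigenspace_iff.1 hw
  refine Module.End.mem_eigenspace_iff.2 ?_
  have hc := S.commutator 1 n S.ω u w
  have ha : antidiagonal 1 = ({(0, 1), (1, 0)} : Finset (ℕ × ℕ)) := rfl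
  rw [ha, Finset.sum_pair (by simp)] at hc
  simp only [Nat.choose_zero_right, Nat.choose_self, Nat.cast_one, Nat.cast_zero, one_smul,
    add_zero, hu', hw', map_smul, LinearMap.smul_apply, S.L_neg_one, add_sub_cancel_right,
    sub_eq_iff_eq_add] at hc
  rw [hc]
  push_cast
  module

/-- The sum of the weight spaces of weight at most `q`. -/
def weightFiltration (q : ℤ) : Submodule ℂ V := ⨆ k : Set.Iic q, S.weightSpace k

theorem weightSpace_le_weightFiltration {k q : ℤ} (h : k ≤ q) :
    S.weightSpace k ≤ S.weightFiltration q :=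
  le_iSup (fun k : Set.Iic q => S.weightSpace k) ⟨k, h⟩

theorem weightFiltration_mono {p q : ℤ} (h : p ≤ q) :
    S.weightFiltration p ≤ S.weightFiltration q :=
  iSup_le fun k => S.weightSpace_le_weightFiltration (le_trans k.2 h)

theorem exists_weightFiltration_eq_bot : ∃ N : ℤ, ∀ q : ℤ, q ≤ N → S.weightFiltration q = ⊥ := by
  obtain ⟨N, hN⟩ := S.bounded_weight
  refine ⟨N - 1, fun q hq => ?_⟩
  rw [weightFiltration, iSup_eq_bot]
  intro k
  have : (k : ℤ) ≤ q := k.2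
  exact hN _ (by omega)

theorem exists_mem_weightFiltration (v : V) : ∃ q : ℤ, v ∈ S.weightFiltration q := by
  have hd : Directed (· ≤ ·) S.weightFiltration :=
    Monotone.directed_le fun _ _ => S.weightFiltration_mono
  rw [← Submodule.mem_iSup_of_directed _ hd]
  have ht : (⨆ n : ℤ, S.weightSpace n) = ⊤ := S.grading.submodule_iSup_eq_top
  have : (⊤ : Submodule ℂ V) ≤ ⨆ q, S.weightFiltration q := by
    rw [← ht]
    exact iSup_mono fun n => S.weightSpace_le_weightFiltration le_rfl
  exact this trivial

theorem mode_mem_weightFiltration {p q : ℤ} {u w : V} (hu : u ∈ S.weightFiltration p)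
    (hw : w ∈ S.weightFiltration q) (n : ℤ) :
    S.mode n u w ∈ S.weightFiltration (p + q - n - 1) := by
  have h : S.weightFiltration p ≤ (⨅ k : Set.Iic q, ⨅ w : S.weightSpace k,
      (S.weightFiltration (p + q - n - 1)).comap ((S.mode n).flip (w : V))) := by
    refine iSup_le fun j => le_iInf fun k => le_iInf fun w => fun u hu => ?_
    have h1 : (j : ℤ) ≤ p := j.2
    have h2 : (k : ℤ) ≤ q := k.2
    exact S.weightSpace_le_weightFiltration (by omega) (S.mode_mem_weightSpace hu w.2 n)
  have h' : S.weightFiltration q ≤ (S.weightFiltration (p + q - n - 1)).comap (S.mode n u) := by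
    refine iSup_le fun k => fun w hw => ?_
    have := h hu
    simp only [Submodule.mem_iInf] at this
    exact this k ⟨w, hw⟩
  exact h' hw

variable {S}

/-- Here weight 1 is used: h_n changes weights by 1 - n - 1 = -n, so h_0 preserves the filtration
and every other h_n strictly lowers it. -/
theorem mode_natCast_mem_weightFiltration {h : V} (hh : h ∈ S.weightSpace 1) {q : ℤ} {w : V}
    (hw : w ∈ S.weightFiltration q) (n : ℕ) : S.mode n h w ∈ S.weightFiltration (q - n) := by
  have := S.mode_mem_weightFiltration (S.weightSpace_le_weightFiltration le_rfl hh) hw n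
  rwa [show 1 + q - (n : ℤ) - 1 = q - n by ring] at this

section Scalars

variable {R : Type*} [CommRing R] [Algebra ℂ R]

theorem rTensor_mem_baseChange (W : Submodule ℂ V) (g : R →ₗ[ℂ] R) {A : R ⊗[ℂ] V}
    (hA : A ∈ W.baseChange R) : g.rTensor V A ∈ W.baseChange R := by
  rw [Submodule.baseChange_eq_span] at hA
  induction hA using Submodule.span_induction generalizing g with
  | zero => rw [map_zero]; exact zero_mem _
  | add x y _ _ hx hy => rw [map_add]; exact add_mem (hx g) (hy g)
  | mem x hx =>
    obtain ⟨v, hv, rfl⟩ := hx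
    exact Submodule.tmul_mem_baseChange_of_mem _ hv
  | smul a x _ hx =>
    -- Since g is only ℂ-linear, the scalar a is absorbed into g; the induction therefore runs over
    -- all g at once.
    have e : g.rTensor V (a • x) = (g ∘ₗ LinearMap.mulLeft ℂ a).rTensor V x := by
      rw [LinearMap.rTensor_comp, LinearMap.comp_apply]
      congr 1
    rw [e]
    exact hx _

/-- The bound depends on the filtration steps alone, since the product has weight at most p + q - n
- i - 1. This uniformity is what controls the products of all terms of two exponential series. -/
theorem exists_scalarMode_baseChange_eq_zero (p q n : ℤ) : ∃ N : ℕ, ∀ i : ℕ, N ≤ i →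
    ∀ A ∈ (S.weightFiltration p).baseChange R, ∀ B ∈ (S.weightFiltration q).baseChange R,
      scalarMode R S.toVertexStructure (n + i) A B = 0 := by
  obtain ⟨N, hN⟩ := S.exists_weightFiltration_eq_bot
  refine ⟨(p + q - n - N).toNat, fun i hi A hA B hB => ?_⟩
  rw [Submodule.baseChange_eq_span] at hA hB
  induction hA using Submodule.span_induction with
  | zero => simp
  | add x y _ _ hx hy => rw [map_add, LinearMap.add_apply, hx, hy, add_zero]
  | smul a x _ hx => rw [map_smul, LinearMap.smul_apply, hx, smul_zero]
  | mem x hx =>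
    obtain ⟨u, hu, rfl⟩ := hx
    induction hB using Submodule.span_induction with
    | zero => simp
    | add x y _ _ hx hy => rw [map_add, hx, hy, add_zero]
    | smul a x _ hx => rw [map_smul, hx, smul_zero]
    | mem x hx =>
      obtain ⟨w, hw, rfl⟩ := hx
      have := S.mode_mem_weightFiltration hu hw (n + i)
      rw [hN _ (by omega), Submodule.mem_bot] at this
      rw [TensorProduct.mk_apply, TensorProduct.mk_apply, scalarMode_tmul, this,
        TensorProduct.tmul_zero]

variable (D : Derivation ℂ R R) (f : R) {h : V}

theorem liftBaseChange_pseudoX_mem_baseChange (hh : h ∈ S.weightSpace 1) {q : ℤ} {A : R ⊗[ℂ] V}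
    (hA : A ∈ (S.weightFiltration q).baseChange R) :
    LinearMap.liftBaseChange R (pseudoX S.toVertexStructure D h f) A ∈
      (S.weightFiltration q).baseChange R := by
  rw [Submodule.baseChange_eq_span] at hA
  induction hA using Submodule.span_induction with
  | zero => rw [map_zero]; exact zero_mem _
  | add x y _ _ hx hy => rw [map_add]; exact add_mem hx hy
  | smul a x _ hx => rw [map_smul]; exact Submodule.smul_mem _ _ hx
  | mem x hx =>
    obtain ⟨v, hv, rfl⟩ := hx
    obtain ⟨N, -, hN⟩ := exists_pseudoX_eq_sum S.toVertexStructure D h f v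
    rw [TensorProduct.mk_apply, LinearMap.liftBaseChange_tmul, one_smul, hN N le_rfl]
    exact Submodule.sum_mem _ fun n _ => Submodule.tmul_mem_baseChange_of_mem _
      (S.weightFiltration_mono (by omega) (mode_natCast_mem_weightFiltration hh hv n))

/-- `X_{h,f} - αf` is nilpotent on the generalized eigenvectors of `h₀` of eigenvalue `α`. -/
theorem pow_liftBaseChange_pseudoX_sub_eq_zero (hh : h ∈ S.weightSpace 1)
    (hcomm : ∀ n : ℕ, Commute (S.mode 0 h) (S.mode n h)) (α : ℂ) {N : ℤ}
    (hN : ∀ q : ℤ, q ≤ N → S.weightFiltration q = ⊥) (m : ℕ) :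
    ∀ (q : ℤ) (k : ℕ) (v : V), q - N + k ≤ m → v ∈ S.weightFiltration q →
      ((S.mode 0 h - α • 1) ^ k : Module.End ℂ V) v = 0 →
      ((LinearMap.liftBaseChange R (pseudoX S.toVertexStructure D h f) -
        (α • f) • (1 : Module.End R (R ⊗[ℂ] V))) ^ m) (1 ⊗ₜ v) = 0 := by
  set Z := LinearMap.liftBaseChange R (pseudoX S.toVertexStructure D h f) -
        (α • f) • (1 : Module.End R (R ⊗[ℂ] V)) with hZ
  -- The quantity q - N + k drops by at least one under each part of Z: h_0 - α lowers k, and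
  -- h_{n+1} lowers q by n + 1 while keeping k. When it is nonpositive, the filtration step
  -- containing v is zero.
  induction m with
  | zero =>
    intro q k v hq hv hk
    have : v = 0 := by
      rw [hN q (by omega)] at hv
      exact (Submodule.mem_bot ℂ).1 hv
    rw [this, TensorProduct.tmul_zero, map_zero]
  | succ m ih =>
    intro q k v hq hv hk
    have hpure : ∀ (a : R) (w : V), (Z ^ m) (1 ⊗ₜ w) = 0 → (Z ^ m) (a ⊗ₜ w) = 0 := by
      intro a w hw
      have : a ⊗ₜ[ℂ] w = a • (1 ⊗ₜ[ℂ] w : R ⊗[ℂ] V) := by simp [TensorProduct.smul_tmul']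
      rw [this, map_smul, hw, smul_zero]
    rcases k with _ | k
    · have : v = 0 := hk
      rw [this, TensorProduct.tmul_zero, map_zero]
    · obtain ⟨M, -, hM⟩ := exists_pseudoX_eq_sum S.toVertexStructure D h f v
      have e : Z (1 ⊗ₜ v) = f ⊗ₜ ((S.mode 0 h - α • 1 : Module.End ℂ V) v) +
          ∑ n ∈ Finset.range M, divPow D (n + 1) f ⊗ₜ[ℂ] S.mode (n + 1 : ℕ) h v := by
        rw [hZ, LinearMap.sub_apply, LinearMap.liftBaseChange_tmul, one_smul, hM (M + 1) (by omega),
          Finset.sum_range_succ', divPow_zero_apply, LinearMap.sub_apply, LinearMap.smul_apply,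
          LinearMap.smul_apply, Module.End.one_apply, Module.End.one_apply,
          TensorProduct.smul_tmul', smul_eq_mul, mul_one, TensorProduct.tmul_sub,
          TensorProduct.smul_tmul, Nat.cast_zero]
        abel
      rw [pow_succ, Module.End.mul_apply, e, map_add, map_sum, hpure, Finset.sum_eq_zero, add_zero]
      · intro n _
        refine hpure _ _ (ih (q - (n + 1 : ℕ)) (k + 1) _ (by push_cast at hq ⊢; omega)
          (mode_natCast_mem_weightFiltration hh hv _) ?_)
        have hc : Commute ((S.mode 0 h - α • 1 : Module.End ℂ V) ^ (k + 1))
            (S.mode (n + 1 : ℕ) h) :=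
          ((hcomm _).sub_left ((Commute.one_left _).smul_left α)).pow_left _
        rw [← Module.End.mul_apply, hc.eq, Module.End.mul_apply, hk, map_zero]
      · refine ih q k _ (by push_cast at hq ⊢; omega) ?_ ?_
        · have := mode_natCast_mem_weightFiltration hh hv 0
          rw [Nat.cast_zero, sub_zero] at this
          exact sub_mem this (Submodule.smul_mem _ _ hv)
        · rw [← Module.End.mul_apply, ← pow_succ, hk]

end Scalars

end VertexOperatorAlgebra

end Weights

/-! ### Adic estimates -/

section Adic

variable {R : Type*} [CommRing R]

section Module

variable {M : Type*} [AddCommGroup M] [Module R M]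

/-- `yᴺ M`. -/
abbrev adic (M : Type*) [AddCommGroup M] [Module R M] (y : R) (N : ℕ) : Submodule R M :=
  Ideal.span {y} ^ N • ⊤

theorem mem_adic_iff {y : R} {N : ℕ} {A : M} : A ∈ adic M y N ↔ ∃ B : M, A = y ^ N • B := by
  rw [adic, Ideal.span_singleton_pow, Submodule.ideal_span_singleton_smul,
    Submodule.mem_smul_pointwise_iff_exists]
  simp [eq_comm]

theorem adic_mono (y : R) {N N' : ℕ} (h : N ≤ N') : adic M y N' ≤ adic M y N :=
  Submodule.smul_mono_left (Ideal.pow_le_pow_right h)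

theorem smul_mem_adic {y a : R} {N : ℕ} (ha : a ∈ Ideal.span {y} ^ N) (A : M) :
    a • A ∈ adic M y N := Submodule.smul_mem_smul ha trivial

theorem map_mem_adic {M' : Type*} [AddCommGroup M'] [Module R M'] (g : M →ₗ[R] M') {y : R} {N : ℕ}
    {A : M} (hA : A ∈ adic M y N) : g A ∈ adic M' y N := by
  obtain ⟨B, rfl⟩ := mem_adic_iff.1 hA
  exact mem_adic_iff.2 ⟨g B, map_smul ..⟩

theorem sub_mem_trans {P : Submodule R M} {a b c : M} (h : a - b ∈ P) (h' : b - c ∈ P) :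
    a - c ∈ P := by
  simpa using P.add_mem h h'

variable [Algebra ℂ R] [Module ℂ M] [IsScalarTower ℂ R M]

theorem csmul_mem {P : Submodule R M} (c : ℂ) {A : M} (hA : A ∈ P) : c • A ∈ P := by
  rw [← algebraMap_smul R c A]; exact P.smul_mem _ hA

theorem restrictScalars_pow_apply (X : Module.End R M) (j : ℕ) (A : M) :
    ((X.restrictScalars ℂ : Module.End ℂ M) ^ j) A = (X ^ j) A := by
  induction j generalizing A with
  | zero => rfl
  | succ j ih => rw [pow_succ, pow_succ, Module.End.mul_apply, Module.End.mul_apply, ih]; rfl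

theorem expTerm_restrictScalars (X : Module.End R M) (j : ℕ) (A : M) :
    expTerm (X.restrictScalars ℂ) j A = ((j ! : ℂ)⁻¹) • (X ^ j) A := by
  rw [expTerm, LinearMap.smul_apply, restrictScalars_pow_apply]

theorem expTerm_restrictScalars_smul (X : Module.End R M) (j : ℕ) (a : R) (A : M) :
    expTerm (X.restrictScalars ℂ) j (a • A) = a • expTerm (X.restrictScalars ℂ) j A := by
  rw [expTerm_restrictScalars, expTerm_restrictScalars, map_smul, smul_comm]

/-- `exp X` converges on `A` to `L`, all terms lie in `F`, and the `j`-th term is divisible by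
`y^{j - c}`. -/
structure ExpConverges (y : R) (X : Module.End R M) (F : Submodule R M) (c : ℕ) (A L : M) :
    Prop where
  term_mem : ∀ j, expTerm (X.restrictScalars ℂ) j A ∈ F
  term_adic : ∀ j, expTerm (X.restrictScalars ℂ) j A ∈ adic M y (j - c)
  lim_mem : L ∈ F
  lim_adic : ∀ n, ∑ j ∈ Finset.range n, expTerm (X.restrictScalars ℂ) j A - L ∈ adic M y (n - c)

namespace ExpConverges

variable {y : R} {X : Module.End R M} {F F' : Submodule R M} {c c' : ℕ} {A A' L L' : M}

theorem mono (h : ExpConverges y X F c A L) (hF : F ≤ F') (hc : c ≤ c') :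
    ExpConverges y X F' c' A L where
  term_mem j := hF (h.term_mem j)
  term_adic j := adic_mono y (by omega) (h.term_adic j)
  lim_mem := hF h.lim_mem
  lim_adic n := adic_mono y (by omega) (h.lim_adic n)

theorem smul (h : ExpConverges y X F c A L) (a : R) : ExpConverges y X F c (a • A) (a • L) where
  term_mem j := by rw [expTerm_restrictScalars_smul]; exact F.smul_mem a (h.term_mem j)
  term_adic j := by
    rw [expTerm_restrictScalars_smul]; exact Submodule.smul_mem _ a (h.term_adic j)
  lim_mem := F.smul_mem a h.lim_mem
  lim_adic n := by
    simp only [expTerm_restrictScalars_smul]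
    rw [← Finset.smul_sum, ← smul_sub]
    exact Submodule.smul_mem _ a (h.lim_adic n)

theorem add (h : ExpConverges y X F c A L) (h' : ExpConverges y X F c A' L') :
    ExpConverges y X F c (A + A') (L + L') where
  term_mem j := by rw [map_add]; exact add_mem (h.term_mem j) (h'.term_mem j)
  term_adic j := by rw [map_add]; exact add_mem (h.term_adic j) (h'.term_adic j)
  lim_mem := add_mem h.lim_mem h'.lim_mem
  lim_adic n := by
    simp only [map_add, Finset.sum_add_distrib]
    rw [add_sub_add_comm]
    exact add_mem (h.lim_adic n) (h'.lim_adic n)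

/-- If `Z` is nilpotent on `A`, then `exp (a + Z)` converges on `A` to `e^a exp Z A`. -/
theorem of_nilpotent {a e : R} {Z : Module.End R M} (ha : a ∈ Ideal.span {y})
    (he : ∀ n, ∑ j ∈ Finset.range n, ((j ! : ℂ)⁻¹) • a ^ j - e ∈ Ideal.span {y} ^ n)
    (hZF : ∀ B ∈ F, Z B ∈ F) (hA : A ∈ F) (hc : (Z ^ c) A = 0) :
    ExpConverges y (a • (1 : Module.End R M) + Z) F c A
      (e • ∑ l ∈ Finset.range c, expTerm (Z.restrictScalars ℂ) l A) := by
  have hZl : ∀ l, expTerm (Z.restrictScalars ℂ) l A ∈ F := by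
    intro l
    rw [expTerm_restrictScalars]
    refine csmul_mem _ ?_
    induction l with
    | zero => exact hA
    | succ l ih => rw [pow_succ', Module.End.mul_apply]; exact hZF _ ih
  have hZ0 : ∀ l, c ≤ l → expTerm (Z.restrictScalars ℂ) l A = 0 := by
    intro l hl
    obtain ⟨d, rfl⟩ := Nat.exists_eq_add_of_le' hl
    rw [expTerm_restrictScalars, pow_add, Module.End.mul_apply, hc, map_zero, smul_zero]
  let g : ℕ → ℕ → M := fun i l => (((i ! : ℂ)⁻¹) • a ^ i) • expTerm (Z.restrictScalars ℂ) l A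
  have hterm : ∀ j, expTerm ((a • (1 : Module.End R M) + Z).restrictScalars ℂ) j A =
      ∑ p ∈ antidiagonal j, g p.1 p.2 := by
    intro j
    have hcom : Commute (((a • (1 : Module.End R M)).restrictScalars ℂ : Module.End ℂ M))
        (Z.restrictScalars ℂ) := by
      ext B; simp
    have hr : ((a • (1 : Module.End R M) + Z).restrictScalars ℂ : Module.End ℂ M) =
      ((a • (1 : Module.End R M)).restrictScalars ℂ : Module.End ℂ M) + Z.restrictScalars ℂ := rfl
    rw [hr, expTerm_add hcom, LinearMap.sum_apply]
    refine Finset.sum_congr rfl fun p _ => ?_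
    rw [Module.End.mul_apply, expTerm_restrictScalars, smul_pow, one_pow, LinearMap.smul_apply,
      Module.End.one_apply, ← smul_assoc]
  have hg : ∀ n i l, n ≤ i + l → g i l ∈ adic M y (n - c) := by
    intro n i l hil
    -- Either Z^l already kills A, or l < c and a^i supplies at least n - c factors of y.
    by_cases hl : c ≤ l
    · simp only [g, hZ0 l hl, smul_zero]; exact zero_mem _
    · refine adic_mono y (by omega : n - c ≤ i) (smul_mem_adic ?_ _)
      rw [← algebraMap_smul R]
      exact Ideal.mul_mem_left _ _ (Ideal.pow_mem_pow ha i)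
  refine ⟨fun j => ?_, fun j => ?_, F.smul_mem _ (sum_mem fun l _ => hZl l), fun n => ?_⟩
  · rw [hterm]
    exact sum_mem fun p _ => F.smul_mem _ (hZl _)
  · rw [hterm]
    exact sum_mem fun p hp =>
      hg _ _ _ (Finset.HasAntidiagonal.mem_antidiagonal.1 hp).ge
  · by_cases hn : c ≤ n
    · simp only [hterm]
      have h1 := sum_rectangle_sub_sum_triangle_mem (adic M y (n - c)).toAddSubgroup g
        (le_refl n) (hg n)
      have h2 : ∑ i ∈ Finset.range n, ∑ l ∈ Finset.range n, g i l -
          e • ∑ l ∈ Finset.range c, expTerm (Z.restrictScalars ℂ) l A ∈ adic M y (n - c) := by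
        have e1 : ∀ i, ∑ l ∈ Finset.range n, g i l = (((i ! : ℂ)⁻¹) • a ^ i) •
            ∑ l ∈ Finset.range c, expTerm (Z.restrictScalars ℂ) l A := by
          intro i
          rw [Finset.smul_sum]
          refine (Finset.sum_subset (Finset.range_subset_range.2 hn) fun l _ hl => ?_).symm
          simp only [g, hZ0 l (by simpa using hl), smul_zero]
        simp only [e1]
        rw [← Finset.sum_smul, ← sub_smul]
        exact adic_mono y (by omega) (smul_mem_adic (he n) _)
      refine sub_mem_trans ?_ h2
      rw [← neg_sub]
      exact neg_mem h1
    -- For n < c the truncated difference n - c is 0, and the claim is empty.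
    · rw [Nat.sub_eq_zero_of_le (by omega)]
      exact mem_adic_iff.2 ⟨_, by rw [pow_zero, one_smul]⟩

end ExpConverges

end Module

variable [Algebra ℂ R] {V : Type*} [AddCommGroup V] [Module ℂ V]

/-- By Leibniz, D(b y^N) is divisible by y^{N-1} whatever Dy is, so each application of D costs at
most one power of y. -/
theorem divPow_mem_pow (D : Derivation ℂ R R) {y : R} {N : ℕ} {a : R}
    (ha : a ∈ Ideal.span {y} ^ N) (i : ℕ) : divPow D i a ∈ Ideal.span {y} ^ (N - i) := by
  have h1 : ∀ (N : ℕ) (a : R), a ∈ Ideal.span {y} ^ N → D a ∈ Ideal.span {y} ^ (N - 1) := by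
    intro N a ha
    rw [Ideal.span_singleton_pow, Ideal.mem_span_singleton'] at ha
    obtain ⟨b, rfl⟩ := ha
    rw [Derivation.leibniz, Derivation.leibniz_pow, Ideal.span_singleton_pow]
    refine add_mem ?_ ?_
    · exact Ideal.mul_mem_left _ _
        (nsmul_mem (Ideal.mul_mem_right _ _ (Ideal.mem_span_singleton_self _)) N)
    · exact Ideal.mul_mem_right _ _
        (Ideal.mem_span_singleton.2 (pow_dvd_pow y (by omega)))
  have h2 : ∀ i : ℕ, ((D : R →ₗ[ℂ] R) ^ i) a ∈ Ideal.span {y} ^ (N - i) := by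
    intro i
    induction i with
    | zero => exact ha
    | succ i ih =>
      rw [pow_succ', Module.End.mul_apply, ← Nat.sub_sub]
      exact h1 _ _ ih
  rw [divPow, LinearMap.smul_apply, ← algebraMap_smul R]
  exact Ideal.mul_mem_left _ _ (h2 i)

theorem rTensor_divPow_mem_adic (D : Derivation ℂ R R) {y : R} {N : ℕ} {A : R ⊗[ℂ] V}
    (hA : A ∈ adic (R ⊗[ℂ] V) y N) (i : ℕ) :
    (divPow D i).rTensor V A ∈ adic (R ⊗[ℂ] V) y (N - i) := by
  obtain ⟨B, rfl⟩ := mem_adic_iff.1 hA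
  rw [rTensor_divPow_smul]
  refine sum_mem fun p hp => ?_
  have := Finset.HasAntidiagonal.mem_antidiagonal.1 hp
  exact adic_mono y (by omega) (smul_mem_adic (divPow_mem_pow D
    (Ideal.pow_mem_pow (Ideal.mem_span_singleton_self y) N) p.1) _)

/-- Only the terms with i < N survive, and the i-th loses at most i powers of y. In the second
argument the product is R-linear and nothing is lost. -/
theorem tensorMode_mem_adic_left (S : VertexStructure V) (D : Derivation ℂ R R) {y : R} {N K : ℕ}
    {n : ℤ} {A B : R ⊗[ℂ] V} (hA : A ∈ adic (R ⊗[ℂ] V) y K)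
    (hN : ∀ i : ℕ, N ≤ i → scalarMode R S (n + i) ((divPow D i).rTensor V A) B = 0) :
    tensorMode S D n A B ∈ adic (R ⊗[ℂ] V) y (K - N) := by
  rw [tensorMode_eq_sum S D hN]
  refine sum_mem fun i hi => ?_
  have := Finset.mem_range.1 hi
  exact map_mem_adic ((scalarMode R S (n + i)).flip B)
    (adic_mono y (by omega) (rTensor_divPow_mem_adic D hA i))

theorem tensorMode_mem_adic_right (S : VertexStructure V) (D : Derivation ℂ R R) {y : R} {K : ℕ}
    {n : ℤ} {A B : R ⊗[ℂ] V} (hB : B ∈ adic (R ⊗[ℂ] V) y K) :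
    tensorMode S D n A B ∈ adic (R ⊗[ℂ] V) y K := by
  obtain ⟨B, rfl⟩ := mem_adic_iff.1 hB
  exact mem_adic_iff.2 ⟨_, tensorMode_smul_right' ..⟩

end Adic

/-! ### The exponential of `X_{h,y}` -/

section Exponential

variable {R : Type*} [CommRing R] [Algebra ℂ R] {V : Type*} [AddCommGroup V] [Module ℂ V]
  {D : Derivation ℂ R R} {y : R} {e : ℂ → R}

/-- The `y`-adic topology of `M` is separated. -/
def AdicSeparated (M : Type*) [AddCommGroup M] [Module R M] (y : R) : Prop :=
  ∀ A : M, (∀ N : ℕ, A ∈ adic M y N) → A = 0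

/-- `e α` is the `y`-adic limit of the exponential series of `αy`. -/
def IsExpFamily (y : R) (e : ℂ → R) : Prop :=
  ∀ (α : ℂ) (n : ℕ), ∑ j ∈ Finset.range n, ((j ! : ℂ)⁻¹) • (α • y) ^ j - e α ∈ Ideal.span {y} ^ n

theorem ExpConverges.unique {M : Type*} [AddCommGroup M] [Module R M] [Module ℂ M]
    [IsScalarTower ℂ R M] (hsep : AdicSeparated M y) {X : Module.End R M} {F F' : Submodule R M}
    {c c' : ℕ} {A L L' : M} (h : ExpConverges y X F c A L) (h' : ExpConverges y X F' c' A L') :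
    L = L' := by
  rw [← sub_eq_zero]
  refine hsep _ fun N => ?_
  have h1 := adic_mono y (by omega) (h.lim_adic (N + c + c')) (N := N)
  have h2 := adic_mono y (by omega) (h'.lim_adic (N + c + c')) (N := N)
  rw [← neg_mem_iff, neg_sub] at h1
  exact sub_mem_trans h1 h2

/-- A property closed under sums that holds for the generalized eigenvectors of a locally finite
operator holds for all vectors. -/
theorem generalized_eigenvector_induction {T : Module.End ℂ V} (hT : IsLocallyFinite T)
    {P : V → Prop} (hadd : ∀ v w, P v → P w → P (v + w))
    (hP : ∀ (α : ℂ) (k : ℕ) (v : V), ((T - α • 1) ^ k : Module.End ℂ V) v = 0 → P v) (v : V) :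
    P v := by
  obtain ⟨U, hU, hv, hTU⟩ := hT v
  let g : Module.End ℂ U := T.restrict hTU
  have hg : ∀ (α : ℂ) (k : ℕ) (u : U), (((g - α • 1) ^ k : Module.End ℂ U) u : V) =
      ((T - α • 1) ^ k : Module.End ℂ V) u := by
    intro α k
    induction k with
    | zero => intro u; rfl
    | succ k ih => intro u; rw [pow_succ, pow_succ, Module.End.mul_apply, ih]; rfl
  have hmem : (⟨v, hv⟩ : U) ∈ ⨆ α, g.maxGenEigenspace α := by
    rw [Module.End.iSup_maxGenEigenspace_eq_top]; trivial
  refine Submodule.iSup_induction _ (motive := fun u : U => P u) hmem (fun α u hu => ?_) ?_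
    (fun u u' hu hu' => hadd _ _ hu hu')
  · obtain ⟨k, hk⟩ := (Module.End.mem_maxGenEigenspace _ _ _).1 hu
    refine hP α k u ?_
    rw [← hg, hk]
    rfl
  · exact hP 0 0 _ rfl

variable {S : VertexOperatorAlgebra V} {h : V}

/-- The `R`-linear extension of `X_{h,y}`. -/
abbrev extX (S : VertexOperatorAlgebra V) (D : Derivation ℂ R R) (y : R) (h : V) :
    Module.End R (R ⊗[ℂ] V) :=
  LinearMap.liftBaseChange R (pseudoX S.toVertexStructure D h y)

/-- The limit is kept explicit because it serves twice: for convergence, and for locating the values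
of the exponential in a smaller coefficient algebra. -/
theorem expConverges_generalized_eigenvector (he : IsExpFamily y e) (hh : h ∈ S.weightSpace 1)
    (hcomm : ∀ n : ℕ, Commute (S.mode 0 h) (S.mode n h)) (α : ℂ) (k : ℕ) (v : V)
    (hv : ((S.mode 0 h - α • 1) ^ k : Module.End ℂ V) v = 0) :
    ∃ (p : ℤ) (c : ℕ), ExpConverges y (extX S D y h) ((S.weightFiltration p).baseChange R) c
      ((1 : R) ⊗ₜ v) (e α • ∑ l ∈ Finset.range c, expTerm ((extX S D y h -
        (α • y) • (1 : Module.End R (R ⊗[ℂ] V))).restrictScalars ℂ) l (1 ⊗ₜ v)) := by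
  obtain ⟨N, hN⟩ := S.exists_weightFiltration_eq_bot
  obtain ⟨q, hq⟩ := S.exists_mem_weightFiltration v
  refine ⟨q, (q - N + k).toNat, ?_⟩
  have := ExpConverges.of_nilpotent (y := y) (a := α • y) (e := e α)
    (Z := extX S D y h - (α • y) • (1 : Module.End R (R ⊗[ℂ] V)))
    (F := (S.weightFiltration q).baseChange R) (A := 1 ⊗ₜ v) (c := (q - N + k).toNat)
    (by rw [← algebraMap_smul R]
        exact Ideal.mul_mem_left _ _ (Ideal.mem_span_singleton_self _))
    (he α)
    (fun B hB => sub_mem (VertexOperatorAlgebra.liftBaseChange_pseudoX_mem_baseChange _ _ hh hB)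
      (Submodule.smul_mem _ _ hB))
    (Submodule.tmul_mem_baseChange_of_mem _ hq)
    (VertexOperatorAlgebra.pow_liftBaseChange_pseudoX_sub_eq_zero _ _ hh hcomm α hN _ q k v
      (by omega) hq hv)
  have e : (α • y) • (1 : Module.End R (R ⊗[ℂ] V)) +
      (extX S D y h - (α • y) • (1 : Module.End R (R ⊗[ℂ] V))) = extX S D y h :=
    LinearMap.ext fun A => add_sub_cancel ((α • y) • A) (extX S D y h A)
  rwa [e] at this

/-- Sums of vectors on which `exp X` converges. -/
theorem ExpConverges.add_weightFiltration {X : Module.End R (R ⊗[ℂ] V)} {p p' : ℤ} {c c' : ℕ}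
    {A A' L L' : R ⊗[ℂ] V}
    (h : ExpConverges y X ((S.weightFiltration p).baseChange R) c A L)
    (h' : ExpConverges y X ((S.weightFiltration p').baseChange R) c' A' L') :
    ExpConverges y X ((S.weightFiltration (max p p')).baseChange R) (max c c') (A + A')
      (L + L') :=
  (h.mono (Submodule.baseChange_mono R (S.weightFiltration_mono (le_max_left ..)))
    (le_max_left ..)).add
    (h'.mono (Submodule.baseChange_mono R (S.weightFiltration_mono (le_max_right ..)))
      (le_max_right ..))

theorem exists_expConverges (he : IsExpFamily y e) (hh : h ∈ S.weightSpace 1)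
    (hcomm : ∀ n : ℕ, Commute (S.mode 0 h) (S.mode n h)) (hfin : IsLocallyFinite (S.mode 0 h))
    (v : V) : ∃ (L : R ⊗[ℂ] V) (p : ℤ) (c : ℕ),
      ExpConverges y (extX S D y h) ((S.weightFiltration p).baseChange R) c (1 ⊗ₜ v) L := by
  refine generalized_eigenvector_induction hfin (P := fun v => ∃ (L : R ⊗[ℂ] V) (p : ℤ) (c : ℕ),
    ExpConverges y (extX S D y h) ((S.weightFiltration p).baseChange R) c (1 ⊗ₜ v) L) ?_
    (fun α k v hv => by
      obtain ⟨p, c, hL⟩ := expConverges_generalized_eigenvector (D := D) he hh hcomm α k v hv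
      exact ⟨_, p, c, hL⟩) v
  rintro v w ⟨L, p, c, hL⟩ ⟨L', p', c', hL'⟩
  refine ⟨L + L', max p p', max c c', ?_⟩
  rw [TensorProduct.tmul_add]
  exact hL.add_weightFiltration hL'

/-- Limits exist vector by vector; uniqueness of limits in the separated topology makes them depend
linearly on the vector. -/
theorem exists_isExp (hsep : AdicSeparated (R ⊗[ℂ] V) y) (he : IsExpFamily y e)
    (hh : h ∈ S.weightSpace 1)
    (hcomm : ∀ n : ℕ, Commute (S.mode 0 h) (S.mode n h)) (hfin : IsLocallyFinite (S.mode 0 h)) :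
    ∃ E : V →ₗ[ℂ] R ⊗[ℂ] V,
      IsExp (Ideal.span {y}) (pseudoX S.toVertexStructure D h y) E := by
  choose L p c hL using exists_expConverges he hh hcomm hfin
  refine ⟨{ toFun := L, map_add' := fun v w => ?_, map_smul' := fun a v => ?_ }, fun v N => ?_⟩
  · have := hL (v + w)
    rw [TensorProduct.tmul_add] at this
    exact this.unique hsep ((hL v).add_weightFiltration (hL w))
  · have := hL (a • v)
    rw [TensorProduct.tmul_smul, ← algebraMap_smul R a (1 ⊗ₜ[ℂ] v : R ⊗[ℂ] V)] at this
    rw [this.unique hsep ((hL v).smul _), algebraMap_smul, RingHom.id_apply]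
  · refine ⟨N + c v, fun n hn => ?_⟩
    have := (hL v).lim_adic n
    simp only [expTerm_restrictScalars] at this
    exact adic_mono y (by omega) this

variable {E : V →ₗ[ℂ] R ⊗[ℂ] V}

theorem IsExp.eq_of_expConverges (hsep : AdicSeparated (R ⊗[ℂ] V) y)
    (hE : IsExp (Ideal.span {y}) (pseudoX S.toVertexStructure D h y) E)
    {F : Submodule R (R ⊗[ℂ] V)} {c : ℕ} {v : V} {L : R ⊗[ℂ] V}
    (hL : ExpConverges y (extX S D y h) F c (1 ⊗ₜ v) L) : E v = L := by
  rw [← sub_eq_zero]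
  refine hsep _ fun N => ?_
  obtain ⟨n₀, hn₀⟩ := hE v N
  have h1 := hn₀ (n₀ + N + c) (by omega)
  have h2 := adic_mono y (by omega) (hL.lim_adic (n₀ + N + c)) (N := N)
  simp only [expTerm_restrictScalars] at h2
  rw [← neg_mem_iff, neg_sub] at h1
  exact sub_mem_trans h1 h2

theorem IsExp.expConverges (hsep : AdicSeparated (R ⊗[ℂ] V) y)
    (he : IsExpFamily y e)
    (hE : IsExp (Ideal.span {y}) (pseudoX S.toVertexStructure D h y) E)
    (hh : h ∈ S.weightSpace 1)
    (hcomm : ∀ n : ℕ, Commute (S.mode 0 h) (S.mode n h)) (hfin : IsLocallyFinite (S.mode 0 h))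
    (A : R ⊗[ℂ] V) : ∃ (p : ℤ) (c : ℕ), ExpConverges y (extX S D y h)
      ((S.weightFiltration p).baseChange R) c A (LinearMap.liftBaseChange R E A) := by
  induction A using TensorProduct.induction_on with
  | zero =>
    obtain ⟨L, p, c, hL⟩ := exists_expConverges he hh hcomm hfin 0
    refine ⟨p, c, ?_⟩
    rw [map_zero]
    have := hL.smul 0
    rwa [zero_smul, zero_smul] at this
  | add A A' hA hA' =>
    obtain ⟨p, c, hA⟩ := hA
    obtain ⟨p', c', hA'⟩ := hA'
    refine ⟨max p p', max c c', ?_⟩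
    rw [map_add]
    exact hA.add_weightFiltration hA'
  | tmul a v =>
    obtain ⟨L, p, c, hL⟩ := exists_expConverges he hh hcomm hfin v
    refine ⟨p, c, ?_⟩
    rw [LinearMap.liftBaseChange_tmul, hE.eq_of_expConverges hsep hL]
    have e : a ⊗ₜ[ℂ] v = a • (1 ⊗ₜ[ℂ] v : R ⊗[ℂ] V) := by simp [TensorProduct.smul_tmul']
    rw [e]
    exact hL.smul a

/-- If `exp X` converges on `A`, `B` and `Aₙ B`, it respects this product. -/
theorem expConverges_tensorMode (hsep : AdicSeparated (R ⊗[ℂ] V) y) {n : ℤ} {A B L L' L'' : R ⊗[ℂ] V} {p q : ℤ} {c c' c'' : ℕ}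
    {F : Submodule R (R ⊗[ℂ] V)}
    (hA : ExpConverges y (extX S D y h) ((S.weightFiltration p).baseChange R) c A L)
    (hB : ExpConverges y (extX S D y h) ((S.weightFiltration q).baseChange R) c' B L')
    (hAB : ExpConverges y (extX S D y h) F c'' (tensorMode S.toVertexStructure D n A B) L'') :
    L'' = tensorMode S.toVertexStructure D n L L' := by
  -- The bundled bilinear form of the product, so that finite sums pass through it.
  set T := (tensorStructure S.toVertexStructure D).mode n with hTdef
  have hT : ∀ A B, T A B = tensorMode S.toVertexStructure D n A B :=
    tensorStructure_mode _ _ _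
  obtain ⟨N₀, hN₀⟩ := VertexOperatorAlgebra.exists_scalarMode_baseChange_eq_zero (S := S) (R := R)
    p q n
  have hleft : ∀ K, ∀ A ∈ (S.weightFiltration p).baseChange R,
      ∀ B ∈ (S.weightFiltration q).baseChange R, A ∈ adic (R ⊗[ℂ] V) y K →
        T A B ∈ adic (R ⊗[ℂ] V) y (K - N₀) := by
    intro K A hA B hB hK
    rw [hT]
    exact tensorMode_mem_adic_left _ _ hK fun i hi =>
      hN₀ i hi _ (VertexOperatorAlgebra.rTensor_mem_baseChange _ _ hA) _ hB
  have hright : ∀ K A B, B ∈ adic (R ⊗[ℂ] V) y K → T A B ∈ adic (R ⊗[ℂ] V) y K := by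
    intro K A B hB
    rw [hT]
    exact tensorMode_mem_adic_right _ _ hB
  rw [← hT] at hAB ⊢
  set x : ℕ → R ⊗[ℂ] V := fun i => expTerm ((extX S D y h).restrictScalars ℂ) i A with hx
  set z : ℕ → R ⊗[ℂ] V := fun i => expTerm ((extX S D y h).restrictScalars ℂ) i B with hz
  have hleib : ∀ j, expTerm ((extX S D y h).restrictScalars ℂ) j (T A B) =
      ∑ r ∈ antidiagonal j, T (x r.1) (z r.2) := by
    intro j
    refine expTerm_bilin T _ _ _ (fun A B => ?_) j A B
    rw [hT, hT, hT]
    exact liftBaseChange_pseudoX_tensorMode S.toVertexAlgebra D h y n A B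
  rw [← sub_eq_zero]
  refine hsep _ fun K => ?_
  -- With this m, i + j ≥ m forces i ≥ K + c + N₀ or j ≥ K + c'. Either way the product of the i-th
  -- and j-th terms is divisible by y^K, N₀ being the loss in the first argument.
  obtain ⟨m, hm⟩ : ∃ m, m = 2 * (K + c + c' + c'' + N₀) := ⟨_, rfl⟩
  have h1 : L'' - ∑ j ∈ Finset.range m, ∑ r ∈ antidiagonal j, T (x r.1) (z r.2) ∈
      adic (R ⊗[ℂ] V) y K := by
    have := adic_mono y (by omega) (hAB.lim_adic m) (N := K)
    rw [← neg_mem_iff, neg_sub] at this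
    simpa only [hleib] using this
  have h2 : ∑ j ∈ Finset.range m, ∑ r ∈ antidiagonal j, T (x r.1) (z r.2) -
      T (∑ i ∈ Finset.range m, x i) (∑ j ∈ Finset.range m, z j) ∈ adic (R ⊗[ℂ] V) y K := by
    rw [← neg_mem_iff, neg_sub, LinearMap.map_sum₂]
    simp only [map_sum]
    refine sum_rectangle_sub_sum_triangle_mem (adic (R ⊗[ℂ] V) y K).toAddSubgroup
      (fun i j => T (x i) (z j)) le_rfl fun i j hij => ?_
    by_cases hi : K + c + N₀ ≤ i
    · exact adic_mono y (by omega) (hleft _ _ (hA.term_mem i) _ (hB.term_mem j) (hA.term_adic i))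
    · exact adic_mono y (by omega) (hright _ (x i) _ (hB.term_adic j))
  have h3 : T (∑ i ∈ Finset.range m, x i) (∑ j ∈ Finset.range m, z j) -
      T L (∑ j ∈ Finset.range m, z j) ∈ adic (R ⊗[ℂ] V) y K := by
    rw [← LinearMap.map_sub₂]
    exact adic_mono y (by omega) (hleft _ _ (sub_mem (sum_mem fun i _ => hA.term_mem i) hA.lim_mem)
      _ (sum_mem fun j _ => hB.term_mem j) (hA.lim_adic m))
  have h4 : T L (∑ j ∈ Finset.range m, z j) - T L L' ∈ adic (R ⊗[ℂ] V) y K := by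
    rw [← map_sub]
    exact adic_mono y (by omega) (hright _ _ _ (hB.lim_adic m))
  exact sub_mem_trans h1 (sub_mem_trans h2 (sub_mem_trans h3 h4))

theorem pseudoX_neg (S : VertexStructure V) (D : Derivation ℂ R R) (h : V) (f : R) :
    pseudoX S D (-h) f = -pseudoX S D h f := by
  ext v
  rw [LinearMap.neg_apply]
  change ∑ᶠ n : ℕ, _ = -∑ᶠ n : ℕ, _
  rw [← finsum_neg_distrib]
  simp [TensorProduct.tmul_neg]

/-- `exp(-X) exp(X) = 1`. -/
theorem liftBaseChange_exp_neg_comp (hsep : AdicSeparated (R ⊗[ℂ] V) y) {E' : V →ₗ[ℂ] R ⊗[ℂ] V}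
    (hE : ∀ A, ∃ (F : Submodule R (R ⊗[ℂ] V)) (c : ℕ), ExpConverges y (extX S D y h) F c A
      (LinearMap.liftBaseChange R E A))
    (hE' : ∀ A, ∃ (F : Submodule R (R ⊗[ℂ] V)) (c : ℕ), ExpConverges y (-extX S D y h) F c A
      (LinearMap.liftBaseChange R E' A)) (A : R ⊗[ℂ] V) :
    LinearMap.liftBaseChange R E' (LinearMap.liftBaseChange R E A) = A := by
  set X : Module.End ℂ (R ⊗[ℂ] V) := (extX S D y h).restrictScalars ℂ with hX
  have hneg : (-extX S D y h).restrictScalars ℂ = -X := rfl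
  rw [← sub_eq_zero]
  refine hsep _ fun K => ?_
  obtain ⟨F, c, hA⟩ := hE A
  obtain ⟨a, ha⟩ : ∃ a, a = K + c + 1 := ⟨_, rfl⟩
  -- The rate c' depends on the truncated sum, hence on a; the second truncation b can only be
  -- chosen afterwards.
  obtain ⟨F', c', hA'⟩ := hE' (∑ i ∈ Finset.range a, expTerm X i A)
  obtain ⟨b, hb⟩ : ∃ b, b = a + K + c' := ⟨_, rfl⟩
  have h1 : LinearMap.liftBaseChange R E' (LinearMap.liftBaseChange R E A) -
      LinearMap.liftBaseChange R E' (∑ i ∈ Finset.range a, expTerm X i A) ∈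
        adic (R ⊗[ℂ] V) y K := by
    rw [← neg_mem_iff, neg_sub, ← map_sub]
    exact map_mem_adic _ (adic_mono y (by omega) (hA.lim_adic a))
  have h2 : LinearMap.liftBaseChange R E' (∑ i ∈ Finset.range a, expTerm X i A) -
      ∑ i ∈ Finset.range a, ∑ j ∈ Finset.range b, expTerm (-X) j (expTerm X i A) ∈
        adic (R ⊗[ℂ] V) y K := by
    have := adic_mono y (by omega) (hA'.lim_adic b) (N := K)
    rw [← neg_mem_iff, neg_sub, hneg] at this
    simp only [map_sum (expTerm (-X) _)] at this
    rwa [Finset.sum_comm] at this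
  have hterm : ∀ i j, expTerm (-X) j (expTerm X i A) =
      (((-1) ^ j : ℂ) * ((i + j).choose i : ℂ)) • expTerm X (i + j) A := by
    intro i j
    have e : expTerm (-X) j = ((-1) ^ j : ℂ) • expTerm X j := by
      rw [expTerm, expTerm, smul_comm, ← neg_one_smul ℂ X, smul_pow]
    rw [e, LinearMap.smul_apply, ← Module.End.mul_apply, expTerm_mul, LinearMap.smul_apply,
      smul_smul, add_comm j i, Nat.choose_symm_add]
  have h3 : ∑ i ∈ Finset.range a, ∑ j ∈ Finset.range b, expTerm (-X) j (expTerm X i A) -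
      ∑ k ∈ Finset.range a, ∑ p ∈ antidiagonal k, expTerm (-X) p.2 (expTerm X p.1 A) ∈
        adic (R ⊗[ℂ] V) y K := by
    refine sum_rectangle_sub_sum_triangle_mem (adic (R ⊗[ℂ] V) y K).toAddSubgroup
      (fun i j => expTerm (-X) j (expTerm X i A)) (by omega) fun i j hij => ?_
    rw [hterm]
    exact csmul_mem _ (adic_mono y (by omega) (hA.term_adic (i + j)))
  have h4 : ∑ k ∈ Finset.range a, ∑ p ∈ antidiagonal k, expTerm (-X) p.2 (expTerm X p.1 A) =
      A := by
    -- Each diagonal sum is a divided power of -X + X = 0, so only k = 0 contributes.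
    have e : ∀ k, ∑ p ∈ antidiagonal k, expTerm (-X) p.2 (expTerm X p.1 A) =
        expTerm (0 : Module.End ℂ (R ⊗[ℂ] V)) k A := by
      intro k
      have hc : Commute (-X) X := LinearMap.ext fun A => by simp
      rw [← neg_add_cancel X, expTerm_add hc, LinearMap.sum_apply,
        ← Finset.Nat.sum_antidiagonal_swap]
      rfl
    simp only [e]
    rw [Finset.sum_eq_single 0]
    · rw [expTerm_zero]; rfl
    · intro k _ hk
      rw [expTerm, zero_pow hk, smul_zero, LinearMap.zero_apply]
    · intro h0
      exact absurd (Finset.mem_range.2 (by omega)) h0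
  rw [h4] at h3
  exact sub_mem_trans h1 (sub_mem_trans h2 h3)

/-- Every h_n with n ≥ 0 kills the vacuum, hence so does X, and the series reduces to its first
term. -/
theorem IsExp.map_vacuum (hsep : AdicSeparated (R ⊗[ℂ] V) y)
    (hE : IsExp (Ideal.span {y}) (pseudoX S.toVertexStructure D h y) E) :
    E S.vacuum = 1 ⊗ₜ S.vacuum := by
  have hX : extX S D y h (1 ⊗ₜ S.vacuum) = 0 := by
    obtain ⟨N, -, hN⟩ := exists_pseudoX_eq_sum S.toVertexStructure D h y S.vacuum
    rw [LinearMap.liftBaseChange_tmul, one_smul, hN N le_rfl]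
    refine Finset.sum_eq_zero fun n _ => ?_
    rw [S.mode_vacuum, TensorProduct.tmul_zero]
  have h0 : extX S D y h = (0 : R) • (1 : Module.End R (R ⊗[ℂ] V)) + extX S D y h := by simp
  have := ExpConverges.of_nilpotent (y := y) (a := 0) (e := 1) (Z := extX S D y h) (F := ⊤)
    (A := 1 ⊗ₜ S.vacuum) (c := 1) (zero_mem _)
    (fun n => by
      rcases n with _ | n
      · simp
      · rw [Finset.sum_range_succ', Finset.sum_eq_zero fun j _ => by simp]
        simp)
    (fun _ _ => trivial) trivial (by rw [pow_one, hX])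
  rw [← h0] at this
  rw [hE.eq_of_expConverges hsep this]
  simp [expTerm_zero]

theorem IsExp.isPseudoAutomorphism (hsep : AdicSeparated (R ⊗[ℂ] V) y)
    (he : IsExpFamily y e)
    (hE : IsExp (Ideal.span {y}) (pseudoX S.toVertexStructure D h y) E)
    (hh : h ∈ S.weightSpace 1)
    (hcomm : ∀ n : ℕ, Commute (S.mode 0 h) (S.mode n h)) (hfin : IsLocallyFinite (S.mode 0 h)) :
    IsPseudoAutomorphism S.toVertexStructure D E := by
  have hconv := hE.expConverges hsep he hh hcomm hfin
  have hmode : ∀ n A B, LinearMap.liftBaseChange R E (tensorMode S.toVertexStructure D n A B) =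
      tensorMode S.toVertexStructure D n (LinearMap.liftBaseChange R E A)
        (LinearMap.liftBaseChange R E B) := by
    intro n A B
    obtain ⟨p, c, hA⟩ := hconv A
    obtain ⟨q, c', hB⟩ := hconv B
    obtain ⟨_, _, hAB⟩ := hconv (tensorMode S.toVertexStructure D n A B)
    exact expConverges_tensorMode hsep hA hB hAB
  -- The inverse is the exponential attached to -h, which satisfies the same hypotheses and has
  -- X_{-h,y} = -X_{h,y}.
  have hneg : ∀ n : ℤ, S.mode n (-h) = -S.mode n h := fun n => map_neg _ _
  have hh' : -h ∈ S.weightSpace 1 := neg_mem hh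
  have hcomm' : ∀ n : ℕ, Commute (S.mode 0 (-h)) (S.mode n (-h)) := fun n => by
    rw [hneg, hneg]; exact ((hcomm n).neg_left).neg_right
  have hfin' : IsLocallyFinite (S.mode 0 (-h)) := fun v => by
    obtain ⟨U, hU, hv, hu⟩ := hfin v
    refine ⟨U, hU, hv, fun u hu' => ?_⟩
    rw [hneg]
    exact neg_mem (hu u hu')
  obtain ⟨E', hE'⟩ := exists_isExp (D := D) hsep he hh' hcomm' hfin'
  have hconv' := hE'.expConverges hsep he hh' hcomm' hfin'
  have hXneg : extX S D y (-h) = -extX S D y h := by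
    ext v
    simp [extX, pseudoX_neg]
  have hXneg' : extX S D y h = -extX S D y (-h) := by
    ext v
    simp [extX, pseudoX_neg]
  have hleft : ∀ A, LinearMap.liftBaseChange R E' (LinearMap.liftBaseChange R E A) = A :=
    liftBaseChange_exp_neg_comp hsep (S := S) (h := h) (fun A => ⟨_, hconv A |>.choose_spec⟩)
      (fun A => ⟨_, by rw [← hXneg]; exact (hconv' A).choose_spec⟩)
  have hright : ∀ A, LinearMap.liftBaseChange R E (LinearMap.liftBaseChange R E' A) = A :=
    liftBaseChange_exp_neg_comp hsep (S := S) (h := -h) (fun A => ⟨_, hconv' A |>.choose_spec⟩)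
      (fun A => ⟨_, by rw [← hXneg']; exact (hconv A).choose_spec⟩)
  refine { map_vacuum := hE.map_vacuum hsep, map_mode := fun n u w => ?_, isAutomorphism := ?_ }
  · have := hmode n (1 ⊗ₜ u) (1 ⊗ₜ w)
    rwa [tensorMode_one_tmul, scalarMode_tmul, LinearMap.liftBaseChange_tmul,
      LinearMap.liftBaseChange_tmul, LinearMap.liftBaseChange_tmul, one_mul, one_smul, one_smul,
      one_smul] at this
  · refine ⟨Function.bijective_iff_has_inverse.2 ⟨_, hleft, hright⟩, ?_, fun n A B => ?_⟩
    · change LinearMap.liftBaseChange R E (1 ⊗ₜ S.vacuum) = 1 ⊗ₜ S.vacuum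
      rw [LinearMap.liftBaseChange_tmul, one_smul, hE.map_vacuum hsep]
    · rw [tensorStructure_mode, tensorStructure_mode]
      exact hmode n A B

end Exponential

/-! ### Functoriality in the coefficient algebra -/

section Functoriality

variable {R : Type*} [CommRing R] [Algebra ℂ R] {R' : Type*} [CommRing R'] [Algebra ℂ R']
  {V : Type*} [AddCommGroup V] [Module ℂ V] (ψ : R →ₐ[ℂ] R')

theorem rTensor_algHom_smul (a : R) (A : R ⊗[ℂ] V) :
    ψ.toLinearMap.rTensor V (a • A) = ψ a • ψ.toLinearMap.rTensor V A := by
  induction A using TensorProduct.induction_on with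
  | zero => simp
  | add x y hx hy => simp only [smul_add, map_add, hx, hy]
  | tmul s v => simp [TensorProduct.smul_tmul']

theorem rTensor_algHom_scalarMode (S : VertexStructure V) (n : ℤ) (A B : R ⊗[ℂ] V) :
    ψ.toLinearMap.rTensor V (scalarMode R S n A B) =
      scalarMode R' S n (ψ.toLinearMap.rTensor V A) (ψ.toLinearMap.rTensor V B) := by
  induction A using TensorProduct.induction_on with
  | zero => simp
  | add x y hx hy => simp only [map_add, LinearMap.add_apply, hx, hy]
  | tmul a u =>
    induction B using TensorProduct.induction_on with
    | zero => simp
    | add x y hx hy => simp only [map_add, hx, hy]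
    | tmul b w => simp [scalarMode_tmul]

variable {ψ} {D : Derivation ℂ R R} {D' : Derivation ℂ R' R'}

theorem algHom_divPow (hψ : ∀ a, ψ (D a) = D' (ψ a)) (i : ℕ) (a : R) :
    ψ (divPow D i a) = divPow D' i (ψ a) := by
  have : ∀ i : ℕ, ψ (((D : R →ₗ[ℂ] R) ^ i) a) = ((D' : R' →ₗ[ℂ] R') ^ i) (ψ a) := by
    intro i
    induction i with
    | zero => rfl
    | succ i ih =>
      rw [pow_succ', pow_succ', Module.End.mul_apply, Module.End.mul_apply, ← ih]
      exact hψ _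
  rw [divPow, divPow, LinearMap.smul_apply, LinearMap.smul_apply, map_smul, this]

theorem rTensor_algHom_tensorMode (hψ : ∀ a, ψ (D a) = D' (ψ a)) (S : VertexStructure V) (n : ℤ)
    (A B : R ⊗[ℂ] V) : ψ.toLinearMap.rTensor V (tensorMode S D n A B) =
      tensorMode S D' n (ψ.toLinearMap.rTensor V A) (ψ.toLinearMap.rTensor V B) := by
  have e : ∀ i : ℕ, ψ.toLinearMap.rTensor V ((divPow D i).rTensor V A) =
      (divPow D' i).rTensor V (ψ.toLinearMap.rTensor V A) := by
    intro i
    rw [← LinearMap.comp_apply, ← LinearMap.comp_apply, ← LinearMap.rTensor_comp,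
      ← LinearMap.rTensor_comp]
    congr 2
    ext a
    exact algHom_divPow hψ i a
  have := (ψ.toLinearMap.rTensor V).toAddMonoidHom.map_finsum (tensorMode_support_finite S D n A B)
  refine this.trans (finsum_congr fun i => ?_)
  rw [← e]
  exact rTensor_algHom_scalarMode ψ S _ _ _

theorem rTensor_algHom_liftBaseChange_pseudoX (hψ : ∀ a, ψ (D a) = D' (ψ a)) (S : VertexStructure V)
    (h : V) (f : R) (A : R ⊗[ℂ] V) :
    ψ.toLinearMap.rTensor V (LinearMap.liftBaseChange R (pseudoX S D h f) A) =
      LinearMap.liftBaseChange R' (pseudoX S D' h (ψ f)) (ψ.toLinearMap.rTensor V A) := by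
  induction A using TensorProduct.induction_on with
  | zero => simp
  | add x y hx hy => simp only [map_add, hx, hy]
  | tmul a v =>
    obtain ⟨N, -, hN⟩ := exists_pseudoX_eq_sum S D h f v
    obtain ⟨N', -, hN'⟩ := exists_pseudoX_eq_sum S D' h (ψ f) v
    rw [LinearMap.liftBaseChange_tmul, rTensor_algHom_smul, LinearMap.rTensor_tmul,
      LinearMap.liftBaseChange_tmul, hN (N + N') (by omega), hN' (N + N') (by omega), map_sum]
    congr 1
    refine Finset.sum_congr rfl fun n _ => ?_
    rw [LinearMap.rTensor_tmul, AlgHom.toLinearMap_apply, algHom_divPow hψ]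

variable {y : R} {y' : R'} {e : ℂ → R'} {S : VertexOperatorAlgebra V} {h : V}
  {E : V →ₗ[ℂ] R' ⊗[ℂ] V}

/-- The range is stable under X, y and e^{αy}, and on a generalized eigenvector the limit is a
finite expression in these. -/
theorem IsExp.mem_range_rTensor (hψ : ∀ a, ψ (D a) = D' (ψ a)) (hy : ψ y = y')
    (hsep : AdicSeparated (R' ⊗[ℂ] V) y') (he : IsExpFamily y' e)
    (hE : IsExp (Ideal.span {y'}) (pseudoX S.toVertexStructure D' h y') E)
    (hh : h ∈ S.weightSpace 1)
    (hcomm : ∀ n : ℕ, Commute (S.mode 0 h) (S.mode n h)) (hfin : IsLocallyFinite (S.mode 0 h))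
    (hr : ∀ α : ℂ, Module.End.HasEigenvalue (S.mode 0 h) α → ∃ a, ψ a = e α)
    (v : V) : E v ∈ LinearMap.range (ψ.toLinearMap.rTensor V) := by
  set ι := ψ.toLinearMap.rTensor V with hι
  have hsmul : ∀ (a : R) (A : R' ⊗[ℂ] V), A ∈ LinearMap.range ι →
      ψ a • A ∈ LinearMap.range ι := by
    rintro a _ ⟨B, rfl⟩
    exact ⟨a • B, rTensor_algHom_smul ..⟩
  have hX : ∀ A ∈ LinearMap.range ι, extX S D' y' h A ∈ LinearMap.range ι := by
    rintro _ ⟨B, rfl⟩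
    refine ⟨LinearMap.liftBaseChange _ (pseudoX S.toVertexStructure D h y) B, ?_⟩
    rw [hι, rTensor_algHom_liftBaseChange_pseudoX hψ, hy]
  refine generalized_eigenvector_induction hfin (P := fun v => E v ∈ LinearMap.range ι)
    (fun v w hv hw => by rw [map_add]; exact add_mem hv hw) (fun α k v hv => ?_) v
  -- Only a nonzero v guarantees that α is an eigenvalue, to which the hypothesis on e^{αy} applies.
  by_cases hv0 : v = 0
  · rw [hv0, map_zero]; exact zero_mem _
  have hα : Module.End.HasEigenvalue (S.mode 0 h) α := by
    refine Module.End.hasEigenvalue_of_hasGenEigenvalue (k := k) ?_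
    intro hbot
    refine hv0 ((Submodule.mem_bot ℂ).1 ?_)
    rw [← hbot, Module.End.mem_genEigenspace_nat]
    exact hv
  obtain ⟨a, ha⟩ := hr α hα
  obtain ⟨p, c, hL⟩ := expConverges_generalized_eigenvector (D := D') he hh hcomm _ k v hv
  rw [hE.eq_of_expConverges hsep hL, ← ha]
  refine hsmul _ _ (sum_mem fun l hl => ?_)
  clear hl
  rw [expTerm_restrictScalars]
  refine Submodule.smul_mem _ _ ?_
  induction l with
  | zero => exact ⟨1 ⊗ₜ v, by simp [hι]⟩
  | succ l ih =>
    rw [pow_succ', Module.End.mul_apply]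
    generalize ((extX S D' y' h - (α • y') • (1 : Module.End R' (R' ⊗[ℂ] V))) ^ l) (1 ⊗ₜ v) = B at ih ⊢
    have e : (extX S D' y' h - (α • y') • (1 : Module.End R' (R' ⊗[ℂ] V))) B =
        extX S D' y' h B - α • ψ y • B := by
      rw [LinearMap.sub_apply, LinearMap.smul_apply, Module.End.one_apply, smul_assoc, hy]
    rw [e]
    exact sub_mem (hX _ ih) (Submodule.smul_mem _ _ (hsmul y _ ih))

theorem exists_isPseudoEndomorphism_of_mem_range (hψ : ∀ a, ψ (D a) = D' (ψ a))
    (hinj : Function.Injective (ψ.toLinearMap.rTensor V))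
    (hE : IsPseudoEndomorphism S.toVertexStructure D' E)
    (hmem : ∀ v, E v ∈ LinearMap.range (ψ.toLinearMap.rTensor V)) :
    ∃ E' : V →ₗ[ℂ] R ⊗[ℂ] V, ψ.toLinearMap.rTensor V ∘ₗ E' = E ∧
      IsPseudoEndomorphism S.toVertexStructure D E' := by
  let E' : V →ₗ[ℂ] R ⊗[ℂ] V :=
    (LinearEquiv.ofInjective _ hinj).symm.toLinearMap ∘ₗ E.codRestrict _ hmem
  have hE' : ∀ v, ψ.toLinearMap.rTensor V (E' v) = E v := fun v =>
    congrArg Subtype.val ((LinearEquiv.ofInjective _ hinj).apply_symm_apply ⟨E v, hmem v⟩)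
  refine ⟨E', LinearMap.ext hE', ?_, fun n u w => ?_⟩
  · apply hinj
    rw [hE', hE.map_vacuum, LinearMap.rTensor_tmul, AlgHom.toLinearMap_apply, map_one]
  · apply hinj
    rw [hE', hE.map_mode, rTensor_algHom_tensorMode hψ, hE', hE']

end Functoriality

/-! ### The coefficient algebra `ℂ[z⁻¹] ⊗ ℂ[[y]]` -/

section PowerSeriesCoefficients

/-- A basis of N turns t into a finite family of power series, each determined by its coefficients.
-/
theorem tensor_powerSeries_eq_zero {N : Type*} [AddCommGroup N] [Module ℂ N]
    {t : PowerSeries ℂ ⊗[ℂ] N} (h : ∀ k : ℕ, (PowerSeries.coeff k).rTensor N t = 0) : t = 0 := by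
  classical
  let b := Module.Basis.ofVectorSpace ℂ N
  have key : ∀ (k : ℕ) (s : PowerSeries ℂ ⊗[ℂ] N) i,
      PowerSeries.coeff k (TensorProduct.equivFinsuppOfBasisRight b s i) =
        TensorProduct.equivFinsuppOfBasisRight b ((PowerSeries.coeff k).rTensor N s) i := by
    intro k s i
    induction s using TensorProduct.induction_on with
    | zero => simp
    | add x y hx hy => simp only [map_add, Finsupp.add_apply, hx, hy]
    | tmul f n => simp
  apply (TensorProduct.equivFinsuppOfBasisRight b).injective
  rw [map_zero]
  ext i k
  rw [key, h]
  simp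

variable {V : Type*} [AddCommGroup V] [Module ℂ V]

/-- `(P ⊗ Q) ⊗ V ≃ Q ⊗ (P ⊗ V)`. -/
def swapFactors (V : Type*) [AddCommGroup V] [Module ℂ V] :
    RY ⊗[ℂ] V ≃ₗ[ℂ] PowerSeries ℂ ⊗[ℂ] (Polynomial ℂ ⊗[ℂ] V) :=
  (TensorProduct.congr (TensorProduct.comm ℂ (Polynomial ℂ) (PowerSeries ℂ))
    (LinearEquiv.refl ℂ V)).trans (TensorProduct.assoc ℂ _ _ _)

theorem one_tmul_mul_tmul (p : Polynomial ℂ) (f g : PowerSeries ℂ) :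
    ((1 ⊗ₜ[ℂ] f : RY) * p ⊗ₜ[ℂ] g) = p ⊗ₜ (f * g) := by
  simp

theorem yY_pow (N : ℕ) :
    yY ^ N = (1 : Polynomial ℂ) ⊗ₜ[ℂ] ((PowerSeries.X : PowerSeries ℂ) ^ N) := by
  rw [yY, Algebra.TensorProduct.tmul_pow, one_pow]

theorem swapFactors_yY_pow_smul (N : ℕ) (A : RY ⊗[ℂ] V) : swapFactors V (yY ^ N • A) =
    (LinearMap.mulLeft ℂ ((PowerSeries.X : PowerSeries ℂ) ^ N)).rTensor _ (swapFactors V A) := by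
  induction A using TensorProduct.induction_on with
  | zero => simp
  | add x y hx hy => simp only [smul_add, map_add, hx, hy]
  | tmul s v =>
    induction s using TensorProduct.induction_on with
    | zero => simp
    | add x y hx hy => simp only [TensorProduct.add_tmul, smul_add, map_add, hx, hy]
    | tmul p f =>
      have e : yY ^ N * p ⊗ₜ[ℂ] f = p ⊗ₜ[ℂ] (PowerSeries.X ^ N * f) := by
        rw [yY_pow]
        exact one_tmul_mul_tmul _ _ _
      rw [TensorProduct.smul_tmul', smul_eq_mul, e]
      simp [swapFactors]

/-- The `y`-adic topology of `V ⊗ ℂ[z⁻¹] ⊗ ℂ[[y]]` is separated. -/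
theorem adicSeparated_yY (V : Type*) [AddCommGroup V] [Module ℂ V] :
    AdicSeparated (RY ⊗[ℂ] V) yY := by
  intro A h
  apply (swapFactors V).injective
  rw [map_zero]
  refine tensor_powerSeries_eq_zero fun k => ?_
  -- Divisibility by y^{k+1} kills the coefficient of y^k.
  obtain ⟨B, rfl⟩ := mem_adic_iff.1 (h (k + 1))
  have e : PowerSeries.coeff k ∘ₗ
      LinearMap.mulLeft ℂ ((PowerSeries.X : PowerSeries ℂ) ^ (k + 1)) = 0 := by
    ext f
    simp [PowerSeries.coeff_X_pow_mul']
  rw [swapFactors_yY_pow_smul, ← LinearMap.comp_apply, ← LinearMap.rTensor_comp, e,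
    LinearMap.rTensor_zero, LinearMap.zero_apply]

/-- The element `e^{αy}` of `ℂ[z⁻¹] ⊗ ℂ[[y]]`. -/
def expY (α : ℂ) : RY := 1 ⊗ₜ PowerSeries.rescale α (PowerSeries.exp ℂ)

theorem isExpFamily_expY : IsExpFamily yY expY := by
  intro α n
  have e : ∀ j : ℕ, ((j ! : ℂ)⁻¹) • (α • yY) ^ j =
      (1 : Polynomial ℂ) ⊗ₜ[ℂ] (((j ! : ℂ)⁻¹ * α ^ j) • (PowerSeries.X : PowerSeries ℂ) ^ j) := by
    intro j
    rw [smul_pow, yY_pow, smul_smul]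
    exact (TensorProduct.tmul_smul _ (1 : Polynomial ℂ) ((PowerSeries.X : PowerSeries ℂ) ^ j)).symm
  simp only [e]
  rw [← TensorProduct.tmul_sum, expY, ← TensorProduct.tmul_sub, Ideal.span_singleton_pow,
    Ideal.mem_span_singleton, yY_pow]
  have : (PowerSeries.X : PowerSeries ℂ) ^ n ∣
      ∑ j ∈ Finset.range n, ((j ! : ℂ)⁻¹ * α ^ j) • (PowerSeries.X : PowerSeries ℂ) ^ j -
        PowerSeries.rescale α (PowerSeries.exp ℂ) := by
    rw [PowerSeries.X_pow_dvd_iff]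
    intro m hm
    simp [PowerSeries.coeff_X_pow, hm, PowerSeries.coeff_exp, mul_comm]
  obtain ⟨g, hg⟩ := this
  exact ⟨1 ⊗ₜ g, by
    rw [hg]
    exact (one_tmul_mul_tmul _ _ _).symm⟩

end PowerSeriesCoefficients

/-! ### The subalgebra ℂ[z⁻¹] ⊗ K_r[y] -/

section SubalgebraValues

variable {V : Type*} [AddCommGroup V] [Module ℂ V]

/-- Tensoring over a field is exact, so the inclusion of K_r[y] in ℂ[[y]] stays injective. -/
theorem inclK_injective (r : ℕ) : Function.Injective (inclK r) :=
  Module.Flat.lTensor_preserves_injective_linearMap (M := Polynomial ℂ) (Kr r).val.toLinearMap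
    Subtype.val_injective

theorem rTensor_inclK_injective (r : ℕ) :
    Function.Injective ((inclK r).toLinearMap.rTensor V) :=
  Module.Flat.rTensor_preserves_injective_linearMap _ (inclK_injective r)

theorem inclK_delK (r : ℕ) (a : RK r) : inclK r (delK r a) = delY (inclK r a) := by
  induction a using TensorProduct.induction_on with
  | zero => simp
  | add x y hx hy => simp only [map_add, hx, hy]
  | tmul p f =>
    change inclK r (dz p ⊗ₜ f + (Polynomial.X * p) ⊗ₜ derivKr r f) =
      dz p ⊗ₜ (f : PowerSeries ℂ) + (Polynomial.X * p) ⊗ₜ PowerSeries.derivative ℂ f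
    rw [map_add]
    rfl

theorem exists_inclK_eq_yY (r : ℕ) : ∃ a : RK r, inclK r a = yY :=
  ⟨1 ⊗ₜ ⟨PowerSeries.X, Algebra.subset_adjoin (Or.inl rfl)⟩, rfl⟩

theorem exists_inclK_eq_expY (r : ℕ) (k : ℤ) : ∃ a : RK r, inclK r a = expY ((k : ℂ) / r) :=
  ⟨1 ⊗ₜ ⟨_, Algebra.subset_adjoin (Or.inr ⟨k, rfl⟩)⟩, rfl⟩

end SubalgebraValues

end PseudoEnd

end

/-! ### Existence, uniqueness and values of exp(X_{h,y}) -/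

open PseudoEnd in
theorem proposition3p19 {V : Type*} [AddCommGroup V] [Module ℂ V]
    (S : VertexOperatorAlgebra V) (h : V) (hwt : h ∈ S.weightSpace 1)
    (hcomm : ∀ m n : ℕ, ⁅S.mode m h, S.mode n h⁆ = 0)
    (hfin : IsLocallyFinite (S.mode 0 h)) :
    (∃! E : V →ₗ[ℂ] RY ⊗[ℂ] V,
      IsExp (Ideal.span {yY}) (pseudoX S.toVertexStructure delY h yY) E) ∧
    ∀ E : V →ₗ[ℂ] RY ⊗[ℂ] V,
      IsExp (Ideal.span {yY}) (pseudoX S.toVertexStructure delY h yY) E →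
      IsPseudoAutomorphism S.toVertexStructure delY E ∧
      ∀ r : ℕ, 0 < r →
        (∀ α : ℂ, Module.End.HasEigenvalue (S.mode 0 h) α → ∃ k : ℤ, α = (k : ℂ) / r) →
        ∃ E' : V →ₗ[ℂ] RK r ⊗[ℂ] V,
          (inclK r).toLinearMap.rTensor V ∘ₗ E' = E ∧
          IsPseudoEndomorphism S.toVertexStructure (delK r) E' := by
  have hc : ∀ n : ℕ, Commute (S.mode 0 h) (S.mode n h) := fun n =>
    commute_iff_lie_eq.2 (by simpa using hcomm 0 n)
  have hsep := adicSeparated_yY V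
  have he := isExpFamily_expY
  obtain ⟨E₀, hE₀⟩ := exists_isExp (D := delY) hsep he hwt hc hfin
  refine ⟨⟨E₀, hE₀, fun E hE => LinearMap.ext fun v => ?_⟩, fun E hE => ?_⟩
  · obtain ⟨L, _, _, hL⟩ := exists_expConverges (D := delY) he hwt hc hfin v
    exact (hE.eq_of_expConverges hsep hL).trans (hE₀.eq_of_expConverges hsep hL).symm
  · have hA := hE.isPseudoAutomorphism hsep he hwt hc hfin
    refine ⟨hA, fun r _ hr => exists_isPseudoEndomorphism_of_mem_range (inclK_delK r)
      (rTensor_inclK_injective r) hA.toIsPseudoEndomorphism ?_⟩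
    obtain ⟨y, hy⟩ := exists_inclK_eq_yY r
    refine hE.mem_range_rTensor (inclK_delK r) hy hsep he hwt hc hfin fun α hα => ?_
    obtain ⟨k, rfl⟩ := hr α hα
    exact exists_inclK_eq_expY r k
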